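/- Graphs are taken in Serre's sense: a graph $X$ has a set $V_X$ of vertices and a set $\mathbf{E}_X$ of directed edges, with origin and terminus maps $o,t:\mathbf{E}_X\to V_X$ and an inversion $e\mapsto\bar e$ satisfying $\bar{\bar e}=e\neq\bar e$, $o(\bar e)=t(e)$ and $t(\bar e)=o(e)$. For a finite graph $Y$, let $\chi(Y)=|V_Y|-\tfrac12|\mathbf{E}_Y|$, and let $\kappa(Y)$ be the number of spanning trees of $Y$. Let $p$ be a prime, let $X$ be a finite connected graph, let $\alpha:\mathbf{E}_X\to\mathbb{Z}_p$ be a function with $\alpha(\bar e)=-\alpha(e)$ for all $e\in\mathbf{E}_X$, and let $(G_v)_{v\in V_X}$ be a family of closed subgroups of $\mathbb{Z}_p$. For $n\ge 0$ put $\Gamma_n=\mathbb{Z}_p/p^n\mathbb{Z}_p$, let $\pi_n:\mathbb{Z}_p\to\Gamma_n$ be the projection, and put $\Gamma_{n,v}=\pi_n(G_v)$, $\mathcal{G}_n=\{(v,\Gamma_{n,v}):v\in V_X\}$ and $\alpha_n=\pi_n\circ\alpha$. Let $X_n=X(\Gamma_n,\mathcal{G}_n,\alpha_n)$ be the finite graph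 whose vertices are the pairs $(v,\sigma+\Gamma_{n,v})$ with $v\in V_X$, $\sigma\in\Gamma_n$, and whose directed edges are the pairs $(e,\sigma)\in\mathbf{E}_X\times\Gamma_n$, with $$o(e,\sigma)=(o(e),\sigma+\Gamma_{n,o(e)}),\qquad t(e,\sigma)=(t(e),\sigma+\alpha_n(e)+\Gamma_{n,t(e)}),\qquad \overline{(e,\sigma)}=(\bar e,\sigma+\alpha_n(e)).$$ **Theorem.** Assume that $X_n$ is connected for every $n\ge 0$ and that $\chi(X_n)<0$ for all sufficiently large $n$. Then there are integers $\mu,\lambda\ge 0$, an integer $\nu$ and an $n_0\ge 0$ such that $$\mathrm{ord}_p(\kappa(X_n))=\mu p^n+\lambda n+\nu\qquad\text{for all } n\ge n_0 .$$ -/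

import Mathlib

/-- A graph in Serre's formalism, with vertices `V` and directed edges `E`: each directed edge has
an origin, a terminus and an inverse edge, and an edge is never its own inverse. Loops and
multiple edges are allowed. -/
structure SerreGraph (V E : Type*) where
  /-- the origin of a directed edge -/
  o : E → V
  /-- the terminus of a directed edge -/
  t : E → V
  /-- the inversion map -/
  bar : E → E
  bar_bar : ∀ e, bar (bar e) = e
  bar_ne : ∀ e, bar e ≠ e
  o_bar : ∀ e, o (bar e) = t e
  t_bar : ∀ e, t (bar e) = o e

namespace SerreGraph

variable {V E : Type*}

/-- Any two vertices are joined by a path of directed edges. -/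
def Connected (X : SerreGraph V E) : Prop :=
  ∀ v w : V, Relation.ReflTransGen (fun a b => ∃ e, X.o e = a ∧ X.t e = b) v w

/-- The equivalence relation identifying a directed edge with its inverse. -/
def edgeSetoid (X : SerreGraph V E) : Setoid E where
  r e f := f = e ∨ f = X.bar e
  iseqv :=
    { refl := fun _ => Or.inl rfl
      symm := by
        rintro e f (rfl | rfl)
        · exact Or.inl rfl
        · exact Or.inr (X.bar_bar e).symm
      trans := by
        rintro e f g (rfl | rfl) (rfl | rfl)
        · exact Or.inl rfl
        · exact Or.inr rfl
        · exact Or.inr rfl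
        · exact Or.inl (X.bar_bar e) }

/-- The undirected edges: the pairs `{e, ē}`. -/
def UEdge (X : SerreGraph V E) : Type _ := Quotient X.edgeSetoid

/-- The undirected edge underlying a directed edge. -/
def toUEdge (X : SerreGraph V E) (e : E) : X.UEdge := Quotient.mk X.edgeSetoid e

theorem toUEdge_bar (X : SerreGraph V E) (e : E) : X.toUEdge (X.bar e) = X.toUEdge e :=
  Quotient.sound (s := X.edgeSetoid) (Or.inr (X.bar_bar e).symm)

/-- The Euler characteristic of a finite graph: the number of vertices minus the number of
undirected edges. -/
noncomputable def eulerChar (X : SerreGraph V E) : ℤ :=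
  (Nat.card V : ℤ) - (Nat.card X.UEdge : ℤ)

/-- A sequence `c 0, …, c n` of `n + 1 ≥ 1` directed edges is a circuit if it is a closed path
(indices are cyclic) whose vertices are distinct and in which no edge is followed by its inverse.
Equivalently, it is an injective morphism from the cyclic graph with `n + 1` vertices. -/
def IsCircuit (X : SerreGraph V E) (n : ℕ) (c : Fin (n + 1) → E) : Prop :=
  (∀ i, X.t (c i) = X.o (c (i + 1))) ∧
    (∀ i, c (i + 1) ≠ X.bar (c i)) ∧
      Function.Injective fun i => X.o (c i)

/-- A tree is a connected non-empty graph without circuits. -/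
def IsTree (X : SerreGraph V E) : Prop :=
  Nonempty V ∧ X.Connected ∧ ∀ (n : ℕ) (c : Fin (n + 1) → E), ¬ X.IsCircuit n c

/-- The subgraph with all the vertices of `X` and a given set `T` of undirected edges. -/
def spanningSubgraph (X : SerreGraph V E) (T : Set X.UEdge) :
    SerreGraph V {e : E // X.toUEdge e ∈ T} where
  o e := X.o e.1
  t e := X.t e.1
  bar e := ⟨X.bar e.1, by rw [X.toUEdge_bar]; exact e.2⟩
  bar_bar e := Subtype.ext (X.bar_bar e.1)
  bar_ne e h := X.bar_ne e.1 (congrArg Subtype.val h)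
  o_bar e := X.o_bar e.1
  t_bar e := X.t_bar e.1

/-- The number `κ(X)` of spanning trees of a finite graph. -/
noncomputable def numSpanningTrees (X : SerreGraph V E) : ℕ :=
  Nat.card {T : Set X.UEdge // (X.spanningSubgraph T).IsTree}

/-- A voltage assignment on `X` with values in an (additively written) group `G`. -/
structure VoltageAssignment (X : SerreGraph V E) (G : Type*) [AddGroup G] where
  /-- the voltage of a directed edge -/
  val : E → G
  val_bar : ∀ e, val (X.bar e) = -val e

/-- The composition of a voltage assignment with a group morphism. -/
def VoltageAssignment.map {X : SerreGraph V E} {G H : Type*} [AddGroup G] [AddGroup H]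
    (α : X.VoltageAssignment G) (f : G →+ H) : X.VoltageAssignment H where
  val e := f (α.val e)
  val_bar e := by rw [α.val_bar, map_neg]

/-- The graph `X(G, 𝒢, α)`. Its vertices are the pairs `(v, σ + G_v)`, its directed edges are the
pairs `(e, σ)`, the edge `(e, σ)` goes from `(o(e), σ + G_{o(e)})` to
`(t(e), σ + α(e) + G_{t(e)})`, and its inverse is `(ē, σ + α(e))`. -/
def derived (X : SerreGraph V E) {G : Type*} [AddGroup G] (𝒢 : V → AddSubgroup G)
    (α : X.VoltageAssignment G) : SerreGraph (Σ v : V, G ⧸ 𝒢 v) (E × G) where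
  o x := ⟨X.o x.1, QuotientAddGroup.mk x.2⟩
  t x := ⟨X.t x.1, QuotientAddGroup.mk (x.2 + α.val x.1)⟩
  bar x := (X.bar x.1, x.2 + α.val x.1)
  bar_bar x := Prod.ext (X.bar_bar x.1) (by simp [α.val_bar])
  bar_ne x h := X.bar_ne x.1 (congrArg Prod.fst h)
  o_bar x := by
    have key : ∀ (v w : V) (_ : v = w) (g : G),
        (⟨v, QuotientAddGroup.mk g⟩ : Σ v : V, G ⧸ 𝒢 v) = ⟨w, QuotientAddGroup.mk g⟩ := by
      rintro v _ rfl g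
      rfl
    exact key _ _ (X.o_bar x.1) _
  t_bar x := by
    have key : ∀ (v w : V) (_ : v = w) (g h : G) (_ : g = h),
        (⟨v, QuotientAddGroup.mk g⟩ : Σ v : V, G ⧸ 𝒢 v) = ⟨w, QuotientAddGroup.mk h⟩ := by
      rintro v _ rfl g _ rfl
      rfl
    exact key _ _ (X.t_bar x.1) _ _ (by simp [α.val_bar])

/-- The projection `π_n : ℤ_p → Γ_n`, where `Γ_n = ℤ_p/p^n ℤ_p` is taken to be `ℤ/p^n ℤ`. -/
noncomputable def towerProj (p : ℕ) [Fact p.Prime] (n : ℕ) : ℤ_[p] →+ ZMod (p ^ n) :=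
  (PadicInt.toZModPow n : ℤ_[p] →+* ZMod (p ^ n)).toAddMonoidHom

/-- The projection `towerProj p n` is onto, and its kernel is `p^n ℤ_p`. -/
theorem towerProj_spec (p : ℕ) [Fact p.Prime] (n : ℕ) :
    Function.Surjective (towerProj p n) ∧
      ∀ x : ℤ_[p], towerProj p n x = 0 ↔ (p : ℤ_[p]) ^ n ∣ x := by
  constructor
  · exact ZMod.ringHom_surjective (PadicInt.toZModPow n : ℤ_[p] →+* ZMod (p ^ n))
  · intro x
    rw [← Ideal.mem_span_singleton, ← PadicInt.ker_toZModPow, RingHom.mem_ker]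
    rfl

/-- The `n`-th layer `X_n = X(Γ_n, 𝒢_n, α_n)` of the branched `ℤ_p`-tower attached to `α` and to
the subgroups `G_v`, where `Γ_{n,v} = π_n(G_v)` and `α_n = π_n ∘ α`. -/
noncomputable def towerLayer {p : ℕ} [Fact p.Prime] (X : SerreGraph V E)
    (𝒢 : V → AddSubgroup ℤ_[p]) (α : X.VoltageAssignment ℤ_[p]) (n : ℕ) :
    SerreGraph (Σ v : V, ZMod (p ^ n) ⧸ (𝒢 v).map (towerProj p n)) (E × ZMod (p ^ n)) :=
  X.derived (fun v => (𝒢 v).map (towerProj p n)) (α.map (towerProj p n))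

end SerreGraph

/-! Write the layer `X_n` as a quotient, on vertices only, of the unbranched cover with vertex set
`V × Γ_n`. If `ι` is the pullback along the quotient map, the Laplacian of `X_n` is `ιᵀ L₀ ι` with
`L₀` the Laplacian of the cover. The matrix-tree theorem, in the rootless form `det (L + u dᵀ) = (∑
u) (∑ d) κ`, turns `κ(X_n)` into a determinant. Moving `ι` around by `det (1 + AB) = det (1 + BA)`
brings this determinant to `V × Γ_n`, with the averaging projection over the groups `Γ_{n,v}`
inserted. Everything there commutes with translation, so the Fourier transform on `Γ_n` splits it
into one block per character (`numSpanningTrees_derived_mul`): up to `κ(X)` and powers of the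
`|Γ_{n,v}|`, `p^n κ(X_n)` is the product over nontrivial characters `ψ` of a `V × V` determinant, in
which the rows of those `v` where `ψ` is nontrivial on `G_v` are replaced by rows of the identity.

A character of `ℤ_p` of large order is trivial on `G_v` only if `G_v = 0`, so its determinant is
`F(ζ - 1)`, where `ζ` is its value at `1` and `F` is a fixed power series over `ℤ_p`, built from the
series `(1 + T)^{α(e)}` (`exists_characterDet_eq`). Comparing the layers `n` and `n + 1` leaves the
product of `F(ζ - 1)` over the primitive `p^{n+1}`-th roots of unity. For large `n` one coefficient
of `F` dominates, so `|F(ζ - 1)| = p^{-μ} |ζ - 1|^l` (`exists_norm_powerSeriesValue_eq`), while `∏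
|ζ - 1| = 1/p`. The valuation of `κ` therefore grows by `μ φ(p^{n+1}) + l + ∑ s_v - 1`, where
`p^{s_v}` is the growth of the factor of `|Γ_{n,v}|`, and the sum telescopes. The slope is
nonnegative: either some `s_v` is positive, or all `G_v` vanish and then `F(0) = 0`, so `l ≥ 1`. -/

section

open Matrix

/-! ### Determinant identities. -/

/-- Summed Cauchy–Binet formula for `A * Aᵀ`. -/
theorem Matrix.factorial_mul_det_mul_transpose {m u R : Type*} [Fintype m] [DecidableEq m]
    [Fintype u] [CommRing R] (A : Matrix m u R) :
    ((Fintype.card m).factorial : R) * (A * Aᵀ).det =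
      ∑ f : m → u, (A.submatrix id f).det ^ 2 := by
  classical
  have h1 : (A * Aᵀ).det = ∑ f : m → u, (∏ i, A i (f i)) * (A.submatrix id f).det := by
    have h0 : (A * Aᵀ) = fun i => ∑ j, A i j • Aᵀ j := by
      ext i k
      simp [Matrix.mul_apply, Finset.sum_apply]
    change detRowAlternating (A * Aᵀ) = _
    rw [h0]
    have := (detRowAlternating (R := R) (n := m)).toMultilinearMap.map_sum
      (fun i (j : u) => A i j • Aᵀ j)
    refine this.trans (Finset.sum_congr rfl fun f _ => ?_)
    have h2 := (detRowAlternating (R := R) (n := m)).toMultilinearMap.map_smul_univ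
      (fun i => A i (f i)) (fun i => Aᵀ (f i))
    refine h2.trans ?_
    rw [smul_eq_mul, ← det_transpose (A.submatrix id f)]
    rfl
  -- Reindexing `f` by each permutation gives `m!` expressions of the same determinant; summed over
  -- `σ`, the signed products assemble into a second factor `det`.
  have h2 : ∀ σ : Equiv.Perm m, (A * Aᵀ).det =
      ∑ f : m → u, (∏ i, A i (f (σ i))) * ((Equiv.Perm.sign σ : ℤ) : R) *
        (A.submatrix id f).det := by
    intro σ
    rw [h1, ← (Equiv.arrowCongr σ (Equiv.refl u)).symm.sum_comp]
    refine Finset.sum_congr rfl fun f _ => ?_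
    have : (A.submatrix id ((Equiv.arrowCongr σ (Equiv.refl u)).symm f)) =
      (A.submatrix id f).submatrix id σ := by
      ext i j; simp [Equiv.arrowCongr]
    rw [this, det_permute', mul_assoc]
    simp [Equiv.arrowCongr]
  have h3 : ∑ _σ : Equiv.Perm m, (A * Aᵀ).det =
      ((Fintype.card m).factorial : R) * (A * Aᵀ).det := by
    rw [Finset.sum_const, Finset.card_univ, Fintype.card_perm, nsmul_eq_mul]
  rw [← h3, Finset.sum_congr rfl fun σ _ => h2 σ, Finset.sum_comm]
  refine Finset.sum_congr rfl fun f _ => ?_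
  rw [← Finset.sum_mul, sq]
  congr 1
  rw [← det_transpose, det_apply']
  refine Finset.sum_congr rfl fun σ _ => ?_
  rw [mul_comm]
  rfl

/-- A rank one perturbation of a matrix with zero row and column sums. -/
theorem Matrix.det_add_vecMulVec_of_sum_eq_zero {V R : Type*} [Fintype V] [DecidableEq V]
    [CommRing R] (M : Matrix V V R) (hr : ∀ v, ∑ w, M v w = 0) (hc : ∀ w, ∑ v, M v w = 0)
    (u d : V → R) (r : V) :
    (M + vecMulVec u d).det = (∑ v, u v) * (∑ v, d v) *
      (M.submatrix (Subtype.val : {v // v ≠ r} → V) Subtype.val).det := by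
  let e := Equiv.sumCompl (fun v => v ≠ r)
  let _ : Unique {v // ¬ v ≠ r} := ⟨⟨⟨r, by simp⟩⟩, fun x => Subtype.ext (not_not.mp x.2)⟩
  have hval : ∀ x : {v // ¬ v ≠ r}, (x : V) = r := fun x => not_not.mp x.2
  have hsum : ∀ g : V → R, ∑ v, g v = (∑ x : {v // v ≠ r}, g x) + g r := by
    intro g
    rw [← e.sum_comp, Fintype.sum_sum_type]
    congr 1
    rw [Fintype.sum_unique]
    exact congrArg g (hval default)
  set A := M.submatrix (Subtype.val : {v // v ≠ r} → V) Subtype.val with hA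
  -- The entries `-1` recover row and column `r` of `M` from `A`; the corner `1` between `P` and `Q`
  -- carries the rank one term. Their determinants are `∑ u` and `∑ d`.
  let P : Matrix ({v // v ≠ r} ⊕ {v // ¬ v ≠ r}) ({v // v ≠ r} ⊕ {v // ¬ v ≠ r}) R :=
    fromBlocks 1 (of fun i _ => u i) (of fun _ _ => -1) (of fun _ _ => u r)
  let Q : Matrix ({v // v ≠ r} ⊕ {v // ¬ v ≠ r}) ({v // v ≠ r} ⊕ {v // ¬ v ≠ r}) R :=
    fromBlocks 1 (of fun _ _ => -1) (of fun _ j => d j) (of fun _ _ => d r)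
  have hPQ : (M + vecMulVec u d).submatrix e e = P * fromBlocks A 0 0 1 * Q := by
    have hcr : ∀ w, M r w = - ∑ x : {v // v ≠ r}, M x w := fun w => by
      have := hc w; rw [hsum] at this; linear_combination this
    have hrr : ∀ v, M v r = - ∑ x : {v // v ≠ r}, M v x := fun v => by
      have := hr v; rw [hsum] at this; linear_combination this
    simp only [P, Q, fromBlocks_multiply]
    ext i j
    rcases i with i | i <;> rcases j with j | j
    · simp [e, A, mul_apply, vecMulVec_apply]
    · simp [e, A, mul_apply, vecMulVec_apply, hval, hrr]
    · simp [e, A, mul_apply, vecMulVec_apply, hval, hcr]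
    · simp [e, A, mul_apply, vecMulVec_apply, hval]
      rw [hrr, Finset.sum_congr rfl fun x _ => hcr _]
      simp
  rw [← det_submatrix_equiv_self e, hPQ, det_mul, det_mul, det_fromBlocks_zero₂₁, det_one,
    mul_one, det_fromBlocks_one₁₁, det_fromBlocks_one₁₁,
    det_unique (n := {v // ¬ v ≠ r}), det_unique (n := {v // ¬ v ≠ r}), hsum u, hsum d]
  simp [mul_apply]
  ring

/-! ### Incidence matrix and Laplacian. -/

namespace SerreGraph

variable {V E : Type*}

/-- A chosen directed edge representing an undirected edge. -/
noncomputable def rep (X : SerreGraph V E) (u : X.UEdge) : E := Quotient.out u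

theorem toUEdge_rep (X : SerreGraph V E) (u : X.UEdge) : X.toUEdge (X.rep u) = u :=
  Quotient.out_eq u

theorem toUEdge_eq_iff (X : SerreGraph V E) {e f : E} :
    X.toUEdge e = X.toUEdge f ↔ f = e ∨ f = X.bar e :=
  Quotient.eq (r := X.edgeSetoid)

instance (X : SerreGraph V E) [Finite E] : Finite X.UEdge := Quotient.finite _

open Classical in
/-- The sign of a directed edge with respect to the chosen representatives. -/
noncomputable def sgn (X : SerreGraph V E) (R : Type*) [Ring R] (e : E) : R :=
  if X.rep (X.toUEdge e) = e then 1 else -1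

theorem sgn_rep (X : SerreGraph V E) (R : Type*) [Ring R] (u : X.UEdge) :
    X.sgn R (X.rep u) = 1 := by
  simp [sgn, toUEdge_rep]

theorem sgn_bar_rep (X : SerreGraph V E) (R : Type*) [Ring R] (u : X.UEdge) :
    X.sgn R (X.bar (X.rep u)) = -1 := by
  simp [sgn, toUEdge_rep, toUEdge_bar, (X.bar_ne (X.rep u)).symm]

theorem eq_rep_or (X : SerreGraph V E) (e : E) :
    e = X.rep (X.toUEdge e) ∨ e = X.bar (X.rep (X.toUEdge e)) :=
  X.toUEdge_eq_iff.mp (X.toUEdge_rep _)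

theorem sum_edges (X : SerreGraph V E) {M : Type*} [AddCommMonoid M] [Fintype E]
    [Fintype X.UEdge] (g : E → M) :
    ∑ e, g e = ∑ u : X.UEdge, (g (X.rep u) + g (X.bar (X.rep u))) := by
  classical
  rw [← Finset.sum_fiberwise (s := Finset.univ) (g := X.toUEdge)]
  refine Finset.sum_congr rfl fun u _ => ?_
  rw [← Finset.sum_pair (X.bar_ne (X.rep u)).symm]
  refine Finset.sum_congr ?_ fun _ _ => rfl
  ext e
  simp only [Finset.mem_filter, Finset.mem_univ, true_and, Finset.mem_insert,
    Finset.mem_singleton]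
  constructor
  · rintro rfl
    exact X.eq_rep_or e
  · rintro (rfl | rfl)
    · exact X.toUEdge_rep u
    · rw [X.toUEdge_bar, X.toUEdge_rep]

section Laplacian

variable [DecidableEq V] (R : Type*) [CommRing R]

/-- The Laplacian matrix of a finite graph. -/
def lap (X : SerreGraph V E) [Fintype E] : Matrix V V R := of fun v w =>
  ∑ e, (if X.o e = v then 1 else 0) * ((if X.o e = w then 1 else 0) - (if X.t e = w then 1 else 0))

/-- The oriented incidence matrix of a graph. -/
noncomputable def incidence (X : SerreGraph V E) : Matrix V X.UEdge R := of fun v u =>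
  (if X.o (X.rep u) = v then 1 else 0) - (if X.t (X.rep u) = v then 1 else 0)

theorem lap_eq_incidence_mul_transpose (X : SerreGraph V E) [Fintype E] [Fintype X.UEdge] :
    X.lap R = X.incidence R * (X.incidence R)ᵀ := by
  ext v w
  simp only [lap, incidence, of_apply, mul_apply, transpose_apply]
  rw [X.sum_edges]
  refine Finset.sum_congr rfl fun u _ => ?_
  rw [X.o_bar, X.t_bar]
  ring

theorem sgn_mul_incidence (X : SerreGraph V E) (v : V) (e : E) :
    X.sgn R e * X.incidence R v (X.toUEdge e) =
      (if X.o e = v then 1 else 0) - (if X.t e = v then 1 else 0) := by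
  rcases X.eq_rep_or e with h | h
  · conv_rhs => rw [h]
    conv_lhs => enter [1]; rw [h]
    rw [sgn_rep, one_mul]
    rfl
  · conv_rhs => rw [h]
    conv_lhs => enter [1]; rw [h]
    rw [sgn_bar_rep, o_bar, t_bar]
    simp only [incidence, of_apply]
    ring

theorem sum_lap_row [Fintype V] (X : SerreGraph V E) [Fintype E] (v : V) :
    ∑ w, X.lap R v w = 0 := by
  simp only [lap, of_apply]
  rw [Finset.sum_comm]
  refine Finset.sum_eq_zero fun e _ => ?_
  rw [← Finset.mul_sum, Finset.sum_sub_distrib]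
  simp

theorem lap_transpose (X : SerreGraph V E) [Fintype E] : (X.lap R)ᵀ = X.lap R := by
  have := Fintype.ofFinite X.UEdge
  rw [lap_eq_incidence_mul_transpose, transpose_mul, transpose_transpose]

theorem sum_lap_col [Fintype V] (X : SerreGraph V E) [Fintype E] (w : V) :
    ∑ v, X.lap R v w = 0 := by
  rw [← X.sum_lap_row R w]
  refine Finset.sum_congr rfl fun v _ => ?_
  conv_lhs => rw [← X.lap_transpose R]
  rfl

theorem sum_incidence_col [Fintype V] (X : SerreGraph V E) (u : X.UEdge) :
    ∑ v, X.incidence R v u = 0 := by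
  simp [incidence, Finset.sum_sub_distrib]

theorem map_lap {S : Type*} [CommRing S] (f : R →+* S) (X : SerreGraph V E) [Fintype E] :
    (X.lap R).map f = X.lap S := by
  ext v w
  simp [lap, apply_ite f]

end Laplacian

/-! ### Circuits and the kernel of the incidence matrix. -/

/-- An infinite walk revisits a vertex; a return of least length, over all starting times, has
distinct vertices. -/
theorem exists_isCircuit_of_walk {F : Type*} [Finite V] (Y : SerreGraph V F) (w : ℕ → F)
    (hw : ∀ i, Y.o (w (i + 1)) = Y.t (w i)) (hb : ∀ i, w (i + 1) ≠ Y.bar (w i)) :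
    ∃ n, ∃ c : Fin (n + 1) → F, Y.IsCircuit n c := by
  classical
  have hex : ∃ d i, 0 < d ∧ Y.o (w i) = Y.o (w (i + d)) := by
    obtain ⟨i, j, hij, h⟩ := Finite.exists_ne_map_eq_of_infinite fun i => Y.o (w i)
    rcases lt_or_gt_of_ne hij with h' | h'
    · exact ⟨j - i, i, by omega, by rw [Nat.add_sub_cancel' h'.le]; exact h⟩
    · exact ⟨i - j, j, by omega, by rw [Nat.add_sub_cancel' h'.le]; exact h.symm⟩
  obtain ⟨i, hd, hi⟩ := Nat.find_spec hex
  have hmin : ∀ m j, 0 < m → m < Nat.find hex → Y.o (w j) ≠ Y.o (w (j + m)) :=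
    fun m j hm hlt h => Nat.find_min hex hlt ⟨j, hm, h⟩
  generalize Nat.find hex = d at hd hi hmin
  obtain ⟨n, rfl⟩ : ∃ n, d = n + 1 := ⟨d - 1, by omega⟩
  have hinj : ∀ a b : ℕ, a < b → b < n + 1 → Y.o (w (i + a)) ≠ Y.o (w (i + b)) := by
    intro a b hab hb h
    have := hmin (b - a) (i + a) (by omega) (by omega)
    rw [show i + a + (b - a) = i + b by omega] at this
    exact this h
  refine ⟨n, fun a => w (i + a), ?_, ?_, ?_⟩
  · intro a
    rcases eq_or_ne a (Fin.last n) with rfl | ha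
    · simp only [Fin.last_add_one, Fin.val_last, Fin.val_zero, add_zero]
      rw [← hw, add_assoc, ← hi]
    · have : ((a + 1 : Fin (n + 1)) : ℕ) = a + 1 :=
        Fin.val_add_one_of_lt (Fin.lt_last_iff_ne_last.mpr ha)
      simp only [this]
      rw [← hw, add_assoc]
  · intro a
    rcases eq_or_ne a (Fin.last n) with rfl | ha
    · simp only [Fin.last_add_one, Fin.val_last, Fin.val_zero, add_zero]
      intro h
      -- Backtracking at the closing point would give a shorter return, except for a loop (`n = 0`)
      -- or a back-and-forth (`n = 1`), both excluded directly.
      have h2 : Y.o (w (i + n)) = Y.o (w (i + 1)) := by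
        rw [hw i, h, Y.t_bar]
      rcases Nat.lt_trichotomy n 1 with h3 | h3 | h3
      · obtain rfl : n = 0 := by omega
        exact Y.bar_ne _ h.symm
      · subst h3
        apply hb i
        rw [h, Y.bar_bar]
      · exact hinj 1 n h3 (by omega) h2.symm
    · have : ((a + 1 : Fin (n + 1)) : ℕ) = a + 1 :=
        Fin.val_add_one_of_lt (Fin.lt_last_iff_ne_last.mpr ha)
      simp only [this]
      exact hb (i + a)
  · intro a b h
    rcases lt_trichotomy (a : ℕ) b with h' | h' | h'
    · exact absurd h (hinj a b h' b.2)
    · exact Fin.ext h'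
    · exact absurd h.symm (hinj b a h' a.2)

theorem exists_isCircuit_of_set {F : Type*} [Finite V] (Y : SerreGraph V F) (S : Set F)
    (hS : S.Nonempty) (h : ∀ e ∈ S, ∃ f ∈ S, Y.o f = Y.t e ∧ f ≠ Y.bar e) :
    ∃ n, ∃ c : Fin (n + 1) → F, Y.IsCircuit n c := by
  choose! g hgS hg using h
  obtain ⟨e, he⟩ := hS
  have hmem : ∀ i, g^[i] e ∈ S := fun i => by
    induction i with
    | zero => exact he
    | succ i ih => rw [Function.iterate_succ_apply']; exact hgS _ ih
  refine Y.exists_isCircuit_of_walk (fun i => g^[i] e) (fun i => ?_) (fun i => ?_)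
  · rw [Function.iterate_succ_apply']; exact (hg _ (hmem i)).1
  · rw [Function.iterate_succ_apply']; exact (hg _ (hmem i)).2

theorem IsCircuit.injective_toUEdge {X : SerreGraph V E} {n : ℕ} {c : Fin (n + 1) → E}
    (h : X.IsCircuit n c) : Function.Injective fun i => X.toUEdge (c i) := by
  intro i j hij
  obtain ⟨h1, h2, h3⟩ := h
  rcases X.toUEdge_eq_iff.mp hij with h' | h'
  · exact h3 (by simp only [h'])
  · have : j = i + 1 := h3 (by simp only; rw [h', X.o_bar, h1])
    exact absurd (this ▸ h') (h2 i)

/-- A kernel vector is a flow conserved at each vertex. An edge of its support cannot be the only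
one at its terminus, so every such edge continues without backtracking. -/
theorem exists_isCircuit_of_incidence [Fintype V] [DecidableEq V] [Fintype E]
    (X : SerreGraph V E)
    [Fintype X.UEdge] (T : Set X.UEdge) {R : Type*} [CommRing R] (y : X.UEdge → R) (hy : y ≠ 0)
    (hT : ∀ u ∉ T, y u = 0) (h : X.incidence R *ᵥ y = 0) :
    ∃ n, ∃ c : Fin (n + 1) → _, (X.spanningSubgraph T).IsCircuit n c := by
  classical
  obtain ⟨u, hu⟩ : ∃ u, y u ≠ 0 := by
    by_contra! h'; exact hy (funext h')
  have hmem : ∀ u, y u ≠ 0 → u ∈ T := fun u hu => by_contra fun h' => hu (hT u h')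
  have key : ∀ v, ∑ f, (if X.o f = v then X.sgn R f * y (X.toUEdge f) else 0) = 0 := by
    intro v
    rw [X.sum_edges]
    have := congrFun h v
    simp only [mulVec, dotProduct, Pi.zero_apply] at this
    refine Eq.trans (Finset.sum_congr rfl fun u _ => ?_) this
    rw [X.toUEdge_bar, X.toUEdge_rep, X.sgn_rep, X.sgn_bar_rep, X.o_bar]
    simp only [incidence, of_apply]
    split_ifs <;> ring
  refine exists_isCircuit_of_set _ {e | y (X.toUEdge e.1) ≠ 0}
    ⟨⟨X.rep u, by rw [X.toUEdge_rep]; exact hmem u hu⟩, by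
      simp only [Set.mem_ofPred_eq, X.toUEdge_rep]; exact hu⟩ ?_
  rintro ⟨e, heT⟩ he
  by_contra! hno
  have hk := key (X.t e)
  rw [Finset.sum_eq_single (X.bar e)] at hk
  · rw [if_pos (X.o_bar e), X.toUEdge_bar] at hk
    apply he
    change y (X.toUEdge e) = 0
    simp only [sgn] at hk
    split_ifs at hk
    · simpa using hk
    · simpa using hk
  · intro f _ hf
    split_ifs with hof
    · by_cases hyf : y (X.toUEdge f) = 0
      · rw [hyf, mul_zero]
      · exact absurd (congrArg Subtype.val (hno ⟨f, hmem _ hyf⟩ hyf hof)) hf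
    · rfl
  · simp

/-- The unit flow around the circuit works; it is nonzero because a circuit uses each undirected
edge at most once. -/
theorem IsCircuit.exists_incidence_mulVec_eq_zero [Fintype V] [DecidableEq V] {X : SerreGraph V E}
    [Fintype X.UEdge] {T : Set X.UEdge} (R : Type*) [CommRing R] [Nontrivial R] {n : ℕ}
    {c : Fin (n + 1) → _} (h : (X.spanningSubgraph T).IsCircuit n c) :
    ∃ y : X.UEdge → R, y ≠ 0 ∧ (∀ u ∉ T, y u = 0) ∧ X.incidence R *ᵥ y = 0 := by
  classical
  have hinj : Function.Injective fun i => X.toUEdge (c i).1 := by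
    have := h.injective_toUEdge
    intro i j hij
    apply this
    rcases X.toUEdge_eq_iff.mp hij with h' | h'
    · exact ((X.spanningSubgraph T).toUEdge_eq_iff).mpr (Or.inl (Subtype.ext h'))
    · exact ((X.spanningSubgraph T).toUEdge_eq_iff).mpr (Or.inr (Subtype.ext h'))
  refine ⟨fun u => ∑ i, if X.toUEdge (c i).1 = u then X.sgn R (c i).1 else 0, ?_, ?_, ?_⟩
  · intro h0
    have := congrFun h0 (X.toUEdge (c 0).1)
    simp only [Pi.zero_apply] at this
    rw [Finset.sum_eq_single 0] at this
    · rw [if_pos rfl] at this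
      simp only [sgn] at this
      split_ifs at this <;> simp at this
    · intro i _ hi
      exact if_neg fun h' => hi (hinj h')
    · simp
  · intro u hu
    refine Finset.sum_eq_zero fun i _ => if_neg ?_
    rintro rfl
    exact hu (c i).2
  · ext v
    simp only [mulVec, dotProduct, Pi.zero_apply, Finset.mul_sum]
    rw [Finset.sum_comm]
    have h1 : ∀ i, ∑ u, X.incidence R v u *
        (if X.toUEdge (c i).1 = u then X.sgn R (c i).1 else 0) =
        (if X.o (c i).1 = v then 1 else 0) - (if X.t (c i).1 = v then 1 else 0) := by
      intro i
      rw [← sgn_mul_incidence]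
      simp [mul_comm]
    rw [Finset.sum_congr rfl fun i _ => h1 i, Finset.sum_sub_distrib, sub_eq_zero,
      ← Equiv.sum_comp (Equiv.addRight (1 : Fin (n + 1)))]
    refine Finset.sum_congr rfl fun i _ => ?_
    have := h.1 i
    change X.t (c i).1 = X.o (c (i + 1)).1 at this
    rw [this]
    rfl

/-! ### Connectedness and the left kernel of the reduced incidence matrix. -/

theorem Connected.eq_of_forall_edge {X : SerreGraph V E} (h : X.Connected) {M : Type*}
    (g : V → M) (hg : ∀ e, g (X.o e) = g (X.t e)) (v w : V) : g v = g w := by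
  induction h v w with
  | refl => rfl
  | tail _ he ih =>
    obtain ⟨e, rfl, rfl⟩ := he
    rw [ih, hg]

/-- A disconnected graph carries a non-constant locally constant function. -/
theorem exists_locallyConstant_of_not_connected {X : SerreGraph V E} (h : ¬ X.Connected)
    (r : V) (M : Type*) [Zero M] [Nontrivial M] :
    ∃ g : V → M, g ≠ 0 ∧ g r = 0 ∧ ∀ e, g (X.o e) = g (X.t e) := by
  classical
  obtain ⟨m, hm⟩ := exists_ne (0 : M)
  let rel := fun a b => ∃ e, X.o e = a ∧ X.t e = b
  have hsymm : ∀ a b, rel a b → rel b a := by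
    rintro a b ⟨e, rfl, rfl⟩
    exact ⟨X.bar e, X.o_bar e, X.t_bar e⟩
  have hS : ∀ a b, Relation.ReflTransGen rel a b → Relation.ReflTransGen rel b a := by
    intro a b hab
    induction hab with
    | refl => exact .refl
    | tail _ hbc ih => exact .head (hsymm _ _ hbc) ih
  obtain ⟨v, hv⟩ : ∃ v, ¬ Relation.ReflTransGen rel r v := by
    by_contra! hall
    exact h fun a b => (hS _ _ (hall a)).trans (hall b)
  refine ⟨fun w => if Relation.ReflTransGen rel r w then 0 else m, fun h0 => ?_, if_pos .refl,
    fun e => ?_⟩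
  · exact hm (by simpa [hv] using congrFun h0 v)
  · have hrel : rel (X.o e) (X.t e) := ⟨e, rfl, rfl⟩
    have : Relation.ReflTransGen rel r (X.o e) ↔ Relation.ReflTransGen rel r (X.t e) :=
      ⟨fun h => h.tail hrel, fun h => h.tail (hsymm _ _ hrel)⟩
    simp only [this]

theorem spanningSubgraph_forall_edge (X : SerreGraph V E) (T : Set X.UEdge) {M : Type*}
    (g : V → M) : (∀ e, g ((X.spanningSubgraph T).o e) = g ((X.spanningSubgraph T).t e)) ↔
      ∀ u ∈ T, g (X.o (X.rep u)) = g (X.t (X.rep u)) := by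
  constructor
  · intro h u hu
    exact h ⟨X.rep u, by rw [X.toUEdge_rep]; exact hu⟩
  · rintro h ⟨e, he⟩
    change g (X.o e) = g (X.t e)
    have := h _ he
    rcases X.eq_rep_or e with h' | h'
    · rw [← h'] at this; exact this
    · rw [h', X.o_bar, X.t_bar]; exact this.symm

section

variable [Fintype V] [DecidableEq V] (R : Type*) [CommRing R]

/-- The incidence matrix with the row of `r` removed. -/
noncomputable def redIncidence (X : SerreGraph V E) (r : V) :
    Matrix {v // v ≠ r} X.UEdge R :=
  (X.incidence R).submatrix Subtype.val id

theorem redIncidence_mul_transpose (X : SerreGraph V E) (r : V) [Fintype E] [Fintype X.UEdge] :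
    X.redIncidence R r * (X.redIncidence R r)ᵀ =
      (X.lap R).submatrix Subtype.val Subtype.val := by
  rw [lap_eq_incidence_mul_transpose]
  rfl

theorem sum_subtype_ne {M : Type*} [AddCommGroup M] (r : V) (g : V → M) :
    ∑ x : {v // v ≠ r}, g x = (∑ v, g v) - g r := by
  rw [← Finset.sum_erase_eq_sub (Finset.mem_univ r)]
  refine (Finset.sum_subtype _ (fun x => ?_) _).symm
  simp

theorem incidence_mulVec_eq_zero {X : SerreGraph V E} {r : V} [Fintype X.UEdge]
    {y : X.UEdge → R} (h : X.redIncidence R r *ᵥ y = 0) : X.incidence R *ᵥ y = 0 := by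
  have h1 : ∀ v, v ≠ r → (X.incidence R *ᵥ y) v = 0 := fun v hv => congrFun h ⟨v, hv⟩
  ext v
  by_cases hv : v = r
  · subst hv
    have hsum : ∑ w, (X.incidence R *ᵥ y) w = 0 := by
      simp only [mulVec, dotProduct]
      rw [Finset.sum_comm]
      refine Finset.sum_eq_zero fun u _ => ?_
      rw [← Finset.sum_mul, sum_incidence_col, zero_mul]
    have := Finset.sum_eq_single (f := fun w => (X.incidence R *ᵥ y) w) v
      (fun w _ hw => h1 w hw) (fun h => absurd (Finset.mem_univ v) h) (s := Finset.univ)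
    rw [hsum] at this
    exact this.symm
  · exact h1 v hv

theorem vecMul_redIncidence (X : SerreGraph V E) (r : V) (g : V → R) (hg : g r = 0)
    (u : X.UEdge) : ∑ v : {v // v ≠ r}, g v * X.redIncidence R r v u =
      g (X.o (X.rep u)) - g (X.t (X.rep u)) := by
  have := sum_subtype_ne r fun v => g v * X.incidence R v u
  refine this.trans ?_
  rw [hg, zero_mul, sub_zero]
  simp [incidence, mul_sub, Finset.sum_sub_distrib]

/-- The left kernel of the reduced incidence matrix restricted to `T` is trivial if and only if
`T` connects the vertices. -/
theorem connected_iff_vecMul (X : SerreGraph V E) (r : V) (T : Set X.UEdge) [Nontrivial R] :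
    (X.spanningSubgraph T).Connected ↔ ∀ g : {v // v ≠ r} → R,
      (∀ u ∈ T, ∑ v, g v * X.redIncidence R r v u = 0) → g = 0 := by
  constructor
  · intro h g hg
    let g' : V → R := fun v => if hv : v ≠ r then g ⟨v, hv⟩ else 0
    have hg' : ∀ v : {v // v ≠ r}, g' v = g v := fun v => dif_pos v.2
    have hr : g' r = 0 := by simp [g']
    have h1 := h.eq_of_forall_edge g' ((X.spanningSubgraph_forall_edge T g').mpr fun u hu => by
      rw [← sub_eq_zero, ← X.vecMul_redIncidence R r g' hr u, ← hg u hu]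
      exact Finset.sum_congr rfl fun v _ => by rw [hg'])
    ext v
    rw [← hg', h1 v r, hr]
    rfl
  · intro h
    by_contra hc
    obtain ⟨g, hg0, hgr, hg⟩ := exists_locallyConstant_of_not_connected hc r R
    rw [spanningSubgraph_forall_edge] at hg
    have := h (fun v => g v) fun u hu => by
      rw [X.vecMul_redIncidence R r g hgr u, hg u hu, sub_self]
    apply hg0
    ext v
    by_cases hv : v = r
    · rw [hv, hgr]; rfl
    · exact congrFun this ⟨v, hv⟩

end

/-! ### The matrix-tree theorem. -/

section MatrixTree

variable [Fintype V] [DecidableEq V] [Fintype E] (X : SerreGraph V E) (r : V)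

theorem isTree_iff_forall_incidence [Fintype X.UEdge] (T : Set X.UEdge) (R : Type*) [CommRing R]
    [Nontrivial R] [Nonempty V] :
    (X.spanningSubgraph T).IsTree ↔ (X.spanningSubgraph T).Connected ∧
      ∀ y : X.UEdge → R, (∀ u ∉ T, y u = 0) → X.incidence R *ᵥ y = 0 → y = 0 := by
  constructor
  · rintro ⟨-, hc, hn⟩
    refine ⟨hc, fun y hyT hy => ?_⟩
    by_contra hy0
    obtain ⟨n, c, h⟩ := X.exists_isCircuit_of_incidence T y hy0 hyT hy
    exact hn n c h
  · rintro ⟨hc, h⟩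
    refine ⟨inferInstance, hc, fun n c hcirc => ?_⟩
    obtain ⟨y, hy0, hyT, hy⟩ := hcirc.exists_incidence_mulVec_eq_zero R
    exact hy0 (h y hyT hy)

/-- Absence of circuits kills the right kernel of the reduced incidence matrix on `T`, connectedness
the left one; so the matrix is square. -/
theorem IsTree.card_eq [Fintype X.UEdge] {T : Set X.UEdge} (h : (X.spanningSubgraph T).IsTree) :
    Nat.card T = Nat.card {v // v ≠ r} := by
  classical
  have : Nonempty V := ⟨r⟩
  obtain ⟨hc, hker⟩ := (X.isTree_iff_forall_incidence T ℚ).mp h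
  let A : Matrix {v // v ≠ r} T ℚ := (X.redIncidence ℚ r).submatrix id Subtype.val
  have hA : Function.Injective A.mulVecLin := by
    rw [injective_iff_map_eq_zero]
    intro y hy
    let y' : X.UEdge → ℚ := fun u => if hu : u ∈ T then y ⟨u, hu⟩ else 0
    have hy' : y' = 0 := by
      refine hker y' (fun u hu => dif_neg hu) (incidence_mulVec_eq_zero ℚ (r := r) ?_)
      rw [← hy]
      ext v
      refine (Fintype.sum_of_injective Subtype.val Subtype.val_injective _ _ (fun u hu => ?_)
        fun u => ?_).symm
      · rw [Subtype.range_coe] at hu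
        simp [y', hu]
      · simp [y', A]
    ext u
    have := congrFun hy' u
    simpa [y'] using this
  have hAt : Function.Injective Aᵀ.mulVecLin := by
    rw [injective_iff_map_eq_zero]
    intro g hg
    refine (X.connected_iff_vecMul ℚ r T).mp hc g fun u hu => ?_
    have := congrFun hg ⟨u, hu⟩
    simp only [mulVecLin_apply, mulVec, dotProduct, A, Pi.zero_apply] at this
    rw [← this]
    exact Finset.sum_congr rfl fun v _ => mul_comm _ _
  have h1 := LinearMap.finrank_le_finrank_of_injective hA
  have h2 := LinearMap.finrank_le_finrank_of_injective hAt
  rw [Module.finrank_fintype_fun_eq_card, Module.finrank_fintype_fun_eq_card] at h1 h2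
  rw [Nat.card_eq_fintype_card, Nat.card_eq_fintype_card]
  exact le_antisymm h1 h2

theorem det_ne_zero_of_connected {K : Type*} [Field K] [Fintype X.UEdge]
    (f : {v // v ≠ r} → X.UEdge) (h : (X.spanningSubgraph (Set.range f)).Connected) :
    ((X.redIncidence K r).submatrix id f).det ≠ 0 := by
  intro h0
  obtain ⟨g, hg0, hg⟩ := Matrix.exists_vecMul_eq_zero_iff.mpr h0
  refine hg0 ((X.connected_iff_vecMul K r _).mp h g ?_)
  rintro _ ⟨i, rfl⟩
  exact congrFun hg i

/-- Connectedness makes the determinant nonzero over every field, hence modulo every prime, so the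
integer is `±1`. -/
theorem det_sq_of_connected [Fintype X.UEdge] (f : {v // v ≠ r} → X.UEdge)
    (h : (X.spanningSubgraph (Set.range f)).Connected) :
    ((X.redIncidence ℤ r).submatrix id f).det ^ 2 = 1 := by
  have hu : ((X.redIncidence ℤ r).submatrix id f).det.natAbs = 1 := by
    by_contra hne
    obtain ⟨q, hq, hdvd⟩ := Nat.exists_prime_and_dvd hne
    have := Fact.mk hq
    apply X.det_ne_zero_of_connected r (K := ZMod q) f h
    have hmap : (X.redIncidence (ZMod q) r).submatrix id f =
        ((X.redIncidence ℤ r).submatrix id f).map (Int.castRingHom (ZMod q)) := by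
      ext i j
      simp [redIncidence, incidence, apply_ite (Int.cast : ℤ → ZMod q)]
    rw [hmap, ← RingHom.mapMatrix_apply, ← RingHom.map_det, eq_intCast,
      ZMod.intCast_zmod_eq_zero_iff_dvd]
    exact Int.natCast_dvd.mpr hdvd
  rw [← Int.natAbs_sq, hu]; rfl

theorem isTree_range_iff [Fintype X.UEdge] (f : {v // v ≠ r} → X.UEdge)
    (hf : Function.Injective f) :
    (X.spanningSubgraph (Set.range f)).IsTree ↔ (X.spanningSubgraph (Set.range f)).Connected := by
  refine ⟨fun h => h.2.1, fun h => ?_⟩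
  have : Nonempty V := ⟨r⟩
  refine (X.isTree_iff_forall_incidence _ ℚ).mpr ⟨h, fun y hyT hy => ?_⟩
  have hdet := X.det_ne_zero_of_connected r (K := ℚ) f h
  have h1 : (X.redIncidence ℚ r).submatrix id f *ᵥ (y ∘ f) = 0 := by
    ext v
    refine Eq.trans ?_ (congrFun hy v.1)
    exact Fintype.sum_of_injective f hf _ _ (fun u hu => by simp [hyT u hu]) fun u => rfl
  have h2 := Matrix.eq_zero_of_mulVec_eq_zero hdet h1
  ext u
  by_cases hu : u ∈ Set.range f
  · obtain ⟨i, rfl⟩ := hu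
    exact congrFun h2 i
  · exact hyT u hu

open Classical in
theorem det_sq_eq [Fintype X.UEdge] (f : {v // v ≠ r} → X.UEdge) :
    ((X.redIncidence ℤ r).submatrix id f).det ^ 2 =
      if Function.Injective f ∧ (X.spanningSubgraph (Set.range f)).IsTree then 1 else 0 := by
  split_ifs with h
  · exact X.det_sq_of_connected r f h.2.2.1
  · rw [sq_eq_zero_iff]
    by_cases hf : Function.Injective f
    · have hc : ¬ (X.spanningSubgraph (Set.range f)).Connected := fun hc =>
        h ⟨hf, (X.isTree_range_iff r f hf).mpr hc⟩
      rw [X.connected_iff_vecMul ℤ r] at hc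
      push Not at hc
      obtain ⟨g, hg, hg0⟩ := hc
      refine Matrix.exists_vecMul_eq_zero_iff.mp ⟨g, hg0, ?_⟩
      ext i
      exact hg _ ⟨i, rfl⟩
    · simp only [Function.Injective, not_forall] at hf
      obtain ⟨i, j, hij, hne⟩ := hf
      refine det_zero_of_column_eq hne fun k => ?_
      simp [hij]

/-- The injective maps onto spanning trees are the enumerations of spanning trees. -/
noncomputable def treeEnumEquiv (m : Type*) :
    (Σ T : {T : Set X.UEdge // (X.spanningSubgraph T).IsTree}, m ≃ T.1) ≃
      {f : m → X.UEdge // Function.Injective f ∧ (X.spanningSubgraph (Set.range f)).IsTree} :=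
  have hrange : ∀ (T : Set X.UEdge) (e : m ≃ T), Set.range (fun i => (e i : X.UEdge)) = T := by
    intro T e
    change Set.range (Subtype.val ∘ e) = _
    rw [EquivLike.range_comp, Subtype.range_coe]
  Equiv.ofBijective (fun s => ⟨fun i => s.2 i, Subtype.val_injective.comp s.2.injective, by
    rw [hrange]; exact s.1.2⟩) (by
    constructor
    · rintro ⟨⟨T, hT⟩, e⟩ ⟨⟨T', hT'⟩, e'⟩ h
      have h1 : (fun i => (e i : X.UEdge)) = fun i => (e' i : X.UEdge) :=
        congrArg Subtype.val h
      obtain rfl : T = T' := by rw [← hrange T e, h1, hrange]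
      obtain rfl : e = e' := Equiv.ext fun i => Subtype.ext (congrFun h1 i)
      rfl
    · rintro ⟨f, hf, hT⟩
      exact ⟨⟨⟨Set.range f, hT⟩, Equiv.ofInjective f hf⟩, rfl⟩)

/-- **Kirchhoff's matrix-tree theorem**. -/
theorem numSpanningTrees_eq_det :
    (X.numSpanningTrees : ℤ) =
      ((X.lap ℤ).submatrix (Subtype.val : {v // v ≠ r} → V) Subtype.val).det := by
  classical
  have := Fintype.ofFinite X.UEdge
  rw [← redIncidence_mul_transpose]
  have h := Matrix.factorial_mul_det_mul_transpose (X.redIncidence ℤ r)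
  rw [Finset.sum_congr rfl fun f _ => X.det_sq_eq r f, Finset.sum_boole] at h
  have hcard : (Finset.univ.filter fun f : {v // v ≠ r} → X.UEdge => Function.Injective f ∧
      (X.spanningSubgraph (Set.range f)).IsTree).card =
      X.numSpanningTrees * (Fintype.card {v // v ≠ r}).factorial := by
    rw [← Fintype.card_subtype, ← Nat.card_eq_fintype_card,
      ← Nat.card_congr (X.treeEnumEquiv _), Nat.card_sigma]
    have : ∀ T : {T : Set X.UEdge // (X.spanningSubgraph T).IsTree},
        Nat.card ({v // v ≠ r} ≃ T.1) = (Fintype.card {v // v ≠ r}).factorial := fun T => by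
      have hT := IsTree.card_eq X r T.2
      rw [Nat.card_eq_fintype_card, Nat.card_eq_fintype_card] at hT
      rw [Nat.card_eq_fintype_card, Fintype.card_equiv (Fintype.equivOfCardEq hT.symm)]
    rw [Finset.sum_congr rfl fun T _ => this T, Finset.sum_const, smul_eq_mul,
      Finset.card_univ, numSpanningTrees, Nat.card_eq_fintype_card]
  rw [hcard, Nat.cast_mul, mul_comm] at h
  exact (mul_right_cancel₀ (mod_cast Nat.factorial_ne_zero _) h).symm

/-- This form singles out no root and leaves `u`, `d` free; for the derived graph they become the
fibre sizes of the vertex quotient. -/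
theorem det_lap_add_vecMulVec (R : Type*) [CommRing R] (u d : V → R) [Nonempty V] :
    (X.lap R + vecMulVec u d).det = (∑ v, u v) * (∑ v, d v) * (X.numSpanningTrees : R) := by
  obtain ⟨r⟩ := ‹Nonempty V›
  rw [Matrix.det_add_vecMulVec_of_sum_eq_zero _ (X.sum_lap_row R) (X.sum_lap_col R) u d r]
  congr 1
  have h := congrArg (Int.castRingHom R) (X.numSpanningTrees_eq_det r)
  rw [RingHom.map_det] at h
  simp only [map_natCast] at h
  rw [h, ← X.map_lap ℤ (Int.castRingHom R)]
  rfl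

/-- If `κ = 0`, then `L + J` (`J` all ones) has a kernel vector `x`. Its quadratic form is `|Bᵀx|² +
(∑ x)²` with `B` the incidence matrix, so `x` is constant on the connected graph and has sum zero.
-/
theorem numSpanningTrees_ne_zero [Nonempty V] (h : X.Connected) : X.numSpanningTrees ≠ 0 := by
  classical
  have := Fintype.ofFinite X.UEdge
  intro h0
  have hdet := X.det_lap_add_vecMulVec ℚ (fun _ => 1) (fun _ => 1)
  rw [h0, Nat.cast_zero, mul_zero] at hdet
  obtain ⟨x, hx0, hx⟩ := Matrix.exists_mulVec_eq_zero_iff.mpr hdet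
  have hq : (∑ u, ((X.incidence ℚ)ᵀ *ᵥ x) u ^ 2) + (∑ v, x v) ^ 2 = 0 := by
    have h1 : x ⬝ᵥ (X.lap ℚ *ᵥ x) = ∑ u, ((X.incidence ℚ)ᵀ *ᵥ x) u ^ 2 := by
      rw [lap_eq_incidence_mul_transpose, ← mulVec_mulVec, dotProduct_mulVec, ← mulVec_transpose]
      simp [dotProduct, sq]
    have h2 : x ⬝ᵥ (vecMulVec (fun _ => (1 : ℚ)) (fun _ => 1) *ᵥ x) = (∑ v, x v) ^ 2 := by
      simp [dotProduct, mulVec, vecMulVec_apply, sq, Finset.sum_mul]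
    rw [← h1, ← h2, ← dotProduct_add, ← add_mulVec, hx, dotProduct_zero]
  have hn : 0 ≤ ∑ u, ((X.incidence ℚ)ᵀ *ᵥ x) u ^ 2 := Finset.sum_nonneg fun _ _ => sq_nonneg _
  have hs : ∑ v, x v = 0 := by
    have := sq_nonneg (∑ v, x v)
    exact pow_eq_zero_iff two_ne_zero |>.mp (by linarith)
  have hz : ∑ u, ((X.incidence ℚ)ᵀ *ᵥ x) u ^ 2 = 0 := by rw [hs] at hq; simpa using hq
  rw [Finset.sum_eq_zero_iff_of_nonneg fun _ _ => sq_nonneg _] at hz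
  have hconst := h.eq_of_forall_edge x fun e => by
    have h1 := pow_eq_zero_iff two_ne_zero |>.mp (hz (X.toUEdge e) (Finset.mem_univ _))
    have h2 : ∑ v, X.sgn ℚ e * (X.incidence ℚ v (X.toUEdge e) * x v) = 0 := by
      rw [← Finset.mul_sum]
      simp only [mulVec, dotProduct, transpose_apply] at h1
      rw [h1, mul_zero]
    simp only [← mul_assoc, sgn_mul_incidence, sub_mul, Finset.sum_sub_distrib] at h2
    simpa [sub_eq_zero] using h2
  apply hx0
  ext v
  rw [Finset.sum_congr rfl fun w _ => hconst w v, Finset.sum_const, nsmul_eq_mul,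
    mul_eq_zero] at hs
  rcases hs with hs | hs
  · simp at hs
  · exact hs

end MatrixTree

end SerreGraph

/-! ### Vertex quotients and Fourier decomposition of derived graphs. -/

/-- The matrix of the pullback along a map. -/
def Matrix.pullback {A W : Type*} [DecidableEq W] (K : Type*) [Zero K] [One K] (q : A → W) :
    Matrix A W K :=
  of fun a w => if q a = w then 1 else 0

/-- With `h` the fibre sizes, `π = h⁻¹ ιᵀ` is a left inverse of `ι`, and `ι π` averages over fibres.
The exchange `det (1 + AB) = det (1 + BA)` moves the determinant from the quotient to the cover. -/
theorem Matrix.det_pullback_conj {A W K : Type*} [Fintype A] [DecidableEq A] [Fintype W]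
    [DecidableEq W] [Field K] (q : A → W) (h : W → K) (hh : ∀ w, h w ≠ 0)
    (hq : ∀ w, ∑ a, (if q a = w then (1 : K) else 0) = h w) (M : Matrix A A K) :
    ((pullback K q)ᵀ * M * pullback K q).det = (∏ w, h w) *
      (1 + (of fun a b => if q a = q b then (h (q a))⁻¹ else 0) * (M - 1)).det := by
  set ι := pullback K q
  set π : Matrix W A K := diagonal (fun w => (h w)⁻¹) * ιᵀ
  have hιι : ιᵀ * ι = diagonal h := by
    ext w w'
    by_cases hw : w = w'
    · subst hw
      simp only [mul_apply, ι, pullback, transpose_apply, of_apply, diagonal_apply_eq, ← hq]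
      exact Finset.sum_congr rfl fun a _ => by split_ifs <;> simp
    · simp only [mul_apply, ι, pullback, transpose_apply, of_apply, diagonal_apply_ne _ hw]
      refine Finset.sum_eq_zero fun a _ => ?_
      by_cases h1 : q a = w
      · rw [if_neg (fun h2 => hw (h1.symm.trans h2)), mul_zero]
      · rw [if_neg h1, zero_mul]
  have hπι : π * ι = 1 := by
    rw [Matrix.mul_assoc, hιι, diagonal_mul_diagonal, ← diagonal_one]
    congr 1
    ext w
    exact inv_mul_cancel₀ (hh w)
  have hιπ : ι * π = of fun a b => if q a = q b then (h (q a))⁻¹ else 0 := by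
    ext a b
    rw [mul_apply]
    simp only [π, diagonal_mul, ι, pullback, transpose_apply, of_apply]
    rw [Finset.sum_eq_single (q a)]
    · simp [eq_comm]
    · intro w _ hw
      rw [if_neg hw.symm, zero_mul]
    · simp
  have h1 : ιᵀ * M * ι = diagonal h * (1 + π * (M - 1) * ι) := by
    rw [Matrix.mul_sub, Matrix.mul_one, Matrix.sub_mul, hπι, add_sub_cancel]
    simp only [π, ← Matrix.mul_assoc]
    rw [diagonal_mul_diagonal]
    have : (fun i => h i * (h i)⁻¹) = fun _ => 1 := by
      ext w; exact mul_inv_cancel₀ (hh w)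
    rw [this, diagonal_one, Matrix.one_mul]
  rw [h1, det_mul, det_diagonal, det_one_add_mul_comm, ← Matrix.mul_assoc, hιπ]

namespace SerreGraph

variable {V E : Type*}

/-- The Laplacian attached to a pair of endpoint maps. -/
def endpointLap {F A : Type*} [Fintype F] [DecidableEq A] (K : Type*) [CommRing K] (o t : F → A) :
    Matrix A A K := of fun a b =>
  ∑ x, (if o x = a then 1 else 0) * ((if o x = b then 1 else 0) - (if t x = b then 1 else 0))

theorem pullback_conj_endpointLap {F A W K : Type*} [Fintype F] [Fintype A] [DecidableEq A]
    [DecidableEq W] [CommRing K] (o t : F → A) (q : A → W) :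
    (pullback K q)ᵀ * endpointLap K o t * pullback K q =
      endpointLap K (q ∘ o) (q ∘ t) := by
  ext w w'
  simp only [mul_apply, transpose_apply, pullback, of_apply, endpointLap, Function.comp]
  simp only [Finset.sum_mul, Finset.mul_sum]
  rw [Finset.sum_congr rfl fun b _ => Finset.sum_comm, Finset.sum_comm]
  refine Finset.sum_congr rfl fun x _ => ?_
  rw [Finset.sum_comm]
  have : ∀ a b, ((if q a = w then (1 : K) else 0) * ((if o x = a then 1 else 0) *
      ((if o x = b then 1 else 0) - (if t x = b then 1 else 0)))) * (if q b = w' then 1 else 0) =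
      ((if o x = a then if q a = w then (1 : K) else 0 else 0)) *
        ((if o x = b then (if q b = w' then 1 else 0) else 0) -
          (if t x = b then (if q b = w' then 1 else 0) else 0)) := by
    intro a b
    split_ifs <;> simp
  simp only [this, ← Finset.mul_sum, Finset.sum_sub_distrib]
  rw [← Finset.sum_mul]
  simp

/-- The Laplacian matrix twisted by a weight on the edges. -/
def twistedLap [DecidableEq V] [Fintype E] (X : SerreGraph V E) {R : Type*} [CommRing R]
    (β : E → R) : Matrix V V R := of fun v w =>
  ∑ e, (if X.o e = v then 1 else 0) *
    ((if X.o e = w then 1 else 0) - β e * (if X.t e = w then 1 else 0))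

/-- The determinant of the twisted Laplacian in which the rows with `ε v = 0` are replaced by those
of the identity matrix. -/
def twistedDet [Fintype V] [DecidableEq V] [Fintype E] (X : SerreGraph V E) {R : Type*}
    [CommRing R] (ε : V → R) (β : E → R) : R :=
  (1 + diagonal ε * (X.twistedLap β - 1)).det

theorem map_twistedDet [Fintype V] [DecidableEq V] [Fintype E] (X : SerreGraph V E) {R S : Type*}
    [CommRing R] [CommRing S] (f : R →+* S) (ε : V → R) (β : E → R) :
    f (X.twistedDet ε β) = X.twistedDet (fun v => f (ε v)) (fun e => f (β e)) := by
  rw [twistedDet, RingHom.map_det, twistedDet]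
  congr 1
  ext v w
  simp [twistedLap, apply_ite f, one_apply]

theorem twistedLap_one [DecidableEq V] [Fintype E] (X : SerreGraph V E) {R : Type*} [CommRing R] :
    X.twistedLap (fun _ => (1 : R)) = X.lap R := by
  ext v w
  simp [twistedLap, lap]

section Fourier

variable [Fintype V] [DecidableEq V] [Fintype E] (X : SerreGraph V E) {N : ℕ} [NeZero N]
  {K : Type*} [Field K] (ψ : AddChar (ZMod N) K)

/-- The Fourier matrix over a finite index set. -/
def fourierMatrix (V : Type*) [DecidableEq V] {N : ℕ} {K : Type*} [Field K]
    (ψ : AddChar (ZMod N) K) : Matrix (V × ZMod N) (V × ZMod N) K :=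
  of fun a b => if a.1 = b.1 then ψ (b.2 * a.2) else 0

theorem det_fourierMatrix_ne_zero [CharZero K] (hψ : ψ.IsPrimitive) :
    (fourierMatrix V ψ).det ≠ 0 := by
  have h : fourierMatrix V ψ * (of fun b a => if b.1 = a.1 then ψ (b.2 * (-a.2)) else 0) =
      (N : K) • (1 : Matrix (V × ZMod N) (V × ZMod N) K) := by
    ext ⟨v, σ⟩ ⟨w, τ⟩
    simp only [fourierMatrix, mul_apply, of_apply, Fintype.sum_prod_type, Matrix.smul_apply, one_apply,
      Prod.mk.injEq, smul_eq_mul]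
    rw [Finset.sum_eq_single v]
    · by_cases hvw : v = w
      · subst hvw
        simp only [if_true, true_and, ← AddChar.map_add_eq_mul, ← mul_add, ← sub_eq_add_neg]
        rw [AddChar.sum_mulShift _ hψ, ZMod.card]
        simp [sub_eq_zero]
      · simp [hvw]
    · intro u _ hu
      simp [hu.symm]
    · simp
  intro h0
  have := congrArg det h
  rw [det_mul, h0, zero_mul, det_smul, det_one, mul_one] at this
  exact pow_ne_zero _ (Nat.cast_ne_zero.mpr (NeZero.ne N)) this.symm

theorem fourierMatrix_mul_blockDiagonal (M : ZMod N → Matrix V V K) (a : V × ZMod N)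
    (w : V) (i : ZMod N) :
    (fourierMatrix V ψ * blockDiagonal M) a (w, i) = ψ (i * a.2) * M i a.1 w := by
  rw [mul_apply, Fintype.sum_prod_type, Finset.sum_eq_single a.1]
  · rw [Finset.sum_eq_single i]
    · simp [fourierMatrix, blockDiagonal_apply]
    · intro j _ hj
      simp [blockDiagonal_apply, hj]
    · simp
  · intro u _ hu
    simp [fourierMatrix, hu.symm]
  · simp

theorem endpointLap_mul_fourierMatrix (α : E → ZMod N) :
    endpointLap K (fun x : E × ZMod N => (X.o x.1, x.2))
      (fun x => (X.t x.1, x.2 + α x.1)) * fourierMatrix V ψ =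
    fourierMatrix V ψ * blockDiagonal fun i => X.twistedLap fun e => ψ (i * α e) := by
  ext ⟨v, σ⟩ ⟨w, i⟩
  rw [fourierMatrix_mul_blockDiagonal, mul_apply]
  simp only [endpointLap, of_apply, twistedLap, Finset.sum_mul, Finset.mul_sum]
  rw [Finset.sum_comm]
  have h1 : ∀ x : E × ZMod N, ∑ b : V × ZMod N,
      (if (X.o x.1, x.2) = (v, σ) then (1 : K) else 0) *
        ((if (X.o x.1, x.2) = b then 1 else 0) - (if (X.t x.1, x.2 + α x.1) = b then 1 else 0)) *
        fourierMatrix V ψ b (w, i) =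
      if x.2 = σ then ψ (i * σ) * ((if X.o x.1 = v then (1 : K) else 0) *
        ((if X.o x.1 = w then 1 else 0) - ψ (i * α x.1) * (if X.t x.1 = w then 1 else 0)))
        else 0 := by
    rintro ⟨e, τ⟩
    simp only [mul_assoc]
    rw [← Finset.mul_sum]
    simp only [sub_mul, Finset.sum_sub_distrib, ite_mul, one_mul,
      zero_mul, Finset.sum_ite_eq, Finset.mem_univ, if_true]
    by_cases hτ : τ = σ
    · subst hτ
      simp only [fourierMatrix, of_apply, Prod.mk.injEq, and_true, if_true, mul_add,
        AddChar.map_add_eq_mul]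
      split_ifs <;> ring
    · simp [hτ]
  rw [Finset.sum_congr rfl fun x _ => h1 x, Fintype.sum_prod_type]
  simp

theorem ones_mul_fourierMatrix (hψ : ψ.IsPrimitive) :
    (of fun _ _ => 1 : Matrix (V × ZMod N) (V × ZMod N) K) * fourierMatrix V ψ =
    fourierMatrix V ψ * blockDiagonal fun i => of fun _ _ => if i = 0 then (N : K) else 0 := by
  ext ⟨v, σ⟩ ⟨w, i⟩
  rw [fourierMatrix_mul_blockDiagonal, mul_apply, Fintype.sum_prod_type,
    Finset.sum_eq_single w]
  · simp only [fourierMatrix, of_apply, if_true, one_mul]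
    simp only [mul_comm i]
    rw [AddChar.sum_mulShift _ hψ, ZMod.card]
    by_cases hi : i = 0
    · simp [hi]
    · simp [hi]
  · intro u _ hu
    simp [fourierMatrix, hu]
  · simp

-- Averaging a character over cosets of `H v` fixes it if it is trivial on `H v` and kills it
-- otherwise, so each block is a 0-1 diagonal matrix.
open Classical in
theorem average_mul_fourierMatrix [CharZero K] (H : V → AddSubgroup (ZMod N)) :
    (of fun a b => if (⟨a.1, QuotientAddGroup.mk a.2⟩ : Σ v, ZMod N ⧸ H v) =
        ⟨b.1, QuotientAddGroup.mk b.2⟩ then ((Nat.card (H a.1) : K))⁻¹ else 0 :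
        Matrix (V × ZMod N) (V × ZMod N) K) * fourierMatrix V ψ =
    fourierMatrix V ψ * blockDiagonal fun i =>
      diagonal fun v => if ∀ σ ∈ H v, ψ (i * σ) = 1 then (1 : K) else 0 := by
  ext ⟨v, σ⟩ ⟨w, i⟩
  rw [fourierMatrix_mul_blockDiagonal, mul_apply, Fintype.sum_prod_type,
    Finset.sum_eq_single w]
  · by_cases hvw : v = w
    · subst hvw
      simp only [of_apply, Sigma.mk.injEq, heq_eq_eq, true_and, fourierMatrix, if_true,
        diagonal_apply_eq]
      let χ : AddChar (H v) K := (ψ.mulShift i).compAddMonoidHom (H v).subtype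
      have hχ : ∀ τ : H v, χ τ = ψ (i * τ) := fun τ => rfl
      have hχ0 : χ = 0 ↔ ∀ σ ∈ H v, ψ (i * σ) = 1 := by
        rw [DFunLike.ext_iff]
        simp only [hχ, Subtype.forall, AddChar.zero_apply]
      have hsum := AddChar.sum_eq_ite χ
      have h2 : ∑ τ : ZMod N, (if (QuotientAddGroup.mk σ : ZMod N ⧸ H v) = QuotientAddGroup.mk τ
          then ((Nat.card (H v) : K))⁻¹ else 0) * ψ (i * τ) =
          ∑ τ : H v, ((Nat.card (H v) : K))⁻¹ * (ψ (i * σ) * χ τ) := by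
        symm
        refine Fintype.sum_of_injective (fun τ : H v => σ + τ) (fun a b hab => ?_) _ _ ?_ ?_
        · exact Subtype.ext (add_left_cancel hab)
        · intro τ hτ
          rw [if_neg, zero_mul]
          intro h
          rw [QuotientAddGroup.eq] at h
          exact hτ ⟨⟨_, h⟩, by simp⟩
        · intro τ
          rw [if_pos, hχ, mul_add, AddChar.map_add_eq_mul]
          rw [QuotientAddGroup.eq]
          simp
      rw [h2, ← Finset.mul_sum, ← Finset.mul_sum, hsum]
      simp only [hχ0]
      have hc : (Nat.card (H v) : K) ≠ 0 := Nat.cast_ne_zero.mpr Nat.card_pos.ne'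
      split_ifs
      · rw [Nat.card_eq_fintype_card] at hc ⊢
        field_simp
      · simp
    · simp [hvw]
  · intro u _ hu
    simp [fourierMatrix, hu]
  · simp

open Classical in
/-- Factorization of the number of spanning trees of a derived graph of a cyclic group. -/
theorem numSpanningTrees_derived_mul [CharZero K] [Nonempty V] (hψ : ψ.IsPrimitive)
    (H : V → AddSubgroup (ZMod N)) (α : X.VoltageAssignment (ZMod N)) :
    ((X.derived H α).numSpanningTrees : K) * N =
      (∏ v, (Nat.card (H v) : K) ^ Nat.card (ZMod N ⧸ H v)) * X.numSpanningTrees *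
        ∏ i ∈ Finset.univ.erase (0 : ZMod N),
          X.twistedDet (fun v => if ∀ σ ∈ H v, ψ (i * σ) = 1 then (1 : K) else 0)
            fun e => ψ (i * α.val e) := by
  have (v : V) : Fintype (ZMod N ⧸ H v) := Fintype.ofFinite _
  let q : V × ZMod N → Σ v, ZMod N ⧸ H v := fun a => ⟨a.1, QuotientAddGroup.mk a.2⟩
  let h : (Σ v, ZMod N ⧸ H v) → K := fun w => Nat.card (H w.1)
  have hh : ∀ w, h w ≠ 0 := fun w => Nat.cast_ne_zero.mpr Nat.card_pos.ne'
  have hq : ∀ w, ∑ a, (if q a = w then (1 : K) else 0) = h w := by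
    rintro ⟨v, s⟩
    obtain ⟨σ, rfl⟩ := QuotientAddGroup.mk_surjective s
    have : h ⟨v, QuotientAddGroup.mk σ⟩ = ∑ τ : H v, 1 := by
      simp [h]
    rw [this]
    symm
    refine Fintype.sum_of_injective (fun τ : H v => (v, σ + τ)) (fun a b hab => ?_) _ _ ?_ ?_
    · exact Subtype.ext (add_left_cancel (Prod.ext_iff.mp hab).2)
    · rintro ⟨u, τ⟩ hτ
      refine if_neg fun h => hτ ?_
      obtain rfl : u = v := congrArg Sigma.fst h
      simp only [q, Sigma.mk.injEq, heq_eq_eq, true_and] at h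
      have h := h.symm
      rw [QuotientAddGroup.eq] at h
      exact ⟨⟨_, h⟩, by simp⟩
    · intro τ
      refine (if_pos ?_).symm
      simp [q]
  let L0 : Matrix (V × ZMod N) (V × ZMod N) K :=
    endpointLap K (fun x : E × ZMod N => (X.o x.1, x.2)) (fun x => (X.t x.1, x.2 + α.val x.1))
  -- The all-ones matrix descends to the rank one term `vecMulVec h h` on the quotient, while on the
  -- Fourier side it affects only the trivial character.
  let J : Matrix (V × ZMod N) (V × ZMod N) K := of fun _ _ => 1
  have hJ : (pullback K q)ᵀ * J * pullback K q = vecMulVec h h := by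
    ext w w'
    simp only [J, pullback, mul_apply, transpose_apply, of_apply, mul_one, vecMulVec_apply, ← hq]
    rw [Finset.mul_sum]
  have hL : (pullback K q)ᵀ * (L0 + J) * pullback K q = (X.derived H α).lap K + vecMulVec h h := by
    rw [Matrix.mul_add, Matrix.add_mul, hJ, pullback_conj_endpointLap]
    rfl
  have hdet := det_pullback_conj q h hh hq (L0 + J)
  have : Nonempty (Σ v, ZMod N ⧸ H v) := ⟨q (Classical.arbitrary V, 0)⟩
  rw [hL, det_lap_add_vecMulVec] at hdet
  have hsum : ∑ w, h w = N * Fintype.card V := by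
    simp_rw [← hq]
    rw [Finset.sum_comm]
    simp [mul_comm]
  have hprod : ∏ w, h w = ∏ v, (Nat.card (H v) : K) ^ Nat.card (ZMod N ⧸ H v) := by
    rw [Fintype.prod_sigma]
    refine Finset.prod_congr rfl fun v _ => ?_
    simp only [h]
    rw [Finset.prod_const, Finset.card_univ, Nat.card_eq_fintype_card (α := ZMod N ⧸ H v)]
  let B : ZMod N → Matrix V V K := fun i =>
    1 + (diagonal fun v => if ∀ σ ∈ H v, ψ (i * σ) = 1 then (1 : K) else 0) *
      ((X.twistedLap fun e => ψ (i * α.val e)) +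
        (of fun _ _ => if i = 0 then (N : K) else 0) - 1)
  have hB : (1 + (of fun a b => if q a = q b then (h (q a))⁻¹ else 0) * (L0 + J - 1)) *
      fourierMatrix V ψ = fourierMatrix V ψ * blockDiagonal B := by
    have hBd : blockDiagonal B = 1 + (blockDiagonal fun i =>
        diagonal fun v => if ∀ σ ∈ H v, ψ (i * σ) = 1 then (1 : K) else 0) *
        ((blockDiagonal fun i => X.twistedLap fun e => ψ (i * α.val e)) +
        (blockDiagonal fun i => of fun _ _ => if i = 0 then (N : K) else 0) - 1) := by
      rw [← blockDiagonal_one, ← blockDiagonal_add, ← blockDiagonal_sub, ← blockDiagonal_mul,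
        ← blockDiagonal_add]
      rfl
    rw [hBd, Matrix.add_mul, Matrix.mul_add, Matrix.one_mul, Matrix.mul_one, Matrix.mul_assoc,
      Matrix.sub_mul, Matrix.add_mul, X.endpointLap_mul_fourierMatrix, ones_mul_fourierMatrix ψ hψ,
      Matrix.one_mul, ← Matrix.mul_add]
    have hsub : ∀ A B : Matrix (V × ZMod N) (V × ZMod N) K,
        fourierMatrix V ψ * (A + B) - fourierMatrix V ψ = fourierMatrix V ψ * (A + B - 1) :=
      fun A B => by rw [Matrix.mul_sub, Matrix.mul_one]
    rw [hsub, ← Matrix.mul_assoc, ← Matrix.mul_assoc]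
    congr 2
    exact average_mul_fourierMatrix ψ H
  have hdetB : (1 + (of fun a b => if q a = q b then (h (q a))⁻¹ else 0) * (L0 + J - 1)).det =
      ∏ i, (B i).det := by
    have := congrArg det hB
    rw [det_mul, det_mul, mul_comm, det_blockDiagonal] at this
    exact mul_left_cancel₀ (det_fourierMatrix_ne_zero ψ hψ) this
  have hB0 : (B 0).det = N * Fintype.card V * Fintype.card V * X.numSpanningTrees := by
    have h1 : B 0 = X.lap K + vecMulVec (fun _ => (N : K)) fun _ => 1 := by
      rw [← X.twistedLap_one]
      ext v w
      simp [B, vecMulVec_apply, one_apply]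
    rw [h1, X.det_lap_add_vecMulVec]
    simp [mul_comm]
  have hBi : ∀ i ∈ Finset.univ.erase (0 : ZMod N), (B i).det =
      X.twistedDet (fun v => if ∀ σ ∈ H v, ψ (i * σ) = 1 then (1 : K) else 0)
        fun e => ψ (i * α.val e) := by
    intro i hi
    have h0 : (of fun _ _ => 0 : Matrix V V K) = 0 := rfl
    simp only [B, if_neg (Finset.ne_of_mem_erase hi), h0, add_zero, twistedDet]
  rw [hdetB, ← Finset.mul_prod_erase _ _ (Finset.mem_univ (0 : ZMod N)), hB0,
    Finset.prod_congr rfl hBi, hsum, hprod] at hdet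
  have hV : (Fintype.card V : K) ≠ 0 := Nat.cast_ne_zero.mpr Fintype.card_ne_zero
  have hN : (N : K) ≠ 0 := Nat.cast_ne_zero.mpr (NeZero.ne N)
  apply mul_left_cancel₀ (mul_ne_zero (mul_ne_zero hV hV) hN)
  linear_combination hdet

end Fourier

end SerreGraph

/-! ### Values of power series over `ℤ_p` on the open unit disc. -/

section PadicEval

variable {p : ℕ} [Fact p.Prime] (K : Type*) [NormedField K] [NormedAlgebra ℚ_[p] K]

/-- The inclusion of `ℤ_p` into a normed field over `ℚ_p`. -/
noncomputable def padicIntInclusion : ℤ_[p] →+* K :=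
  (algebraMap ℚ_[p] K).comp PadicInt.Coe.ringHom

theorem norm_padicIntInclusion (x : ℤ_[p]) : ‖padicIntInclusion K x‖ = ‖x‖ := by
  simp only [padicIntInclusion, RingHom.comp_apply, norm_algebraMap']
  rfl

variable {K}

/-- The value of a power series over `ℤ_p`. -/
noncomputable def powerSeriesValue (z : K) (f : PowerSeries ℤ_[p]) : K :=
  ∑' n, padicIntInclusion K (PowerSeries.coeff n f) * z ^ n

theorem norm_coeff_mul_pow_le (z : K) (f : PowerSeries ℤ_[p]) (n : ℕ) :
    ‖padicIntInclusion K (PowerSeries.coeff n f) * z ^ n‖ ≤ ‖z‖ ^ n := by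
  rw [norm_mul, norm_padicIntInclusion, norm_pow]
  exact mul_le_of_le_one_left (by positivity) (PadicInt.norm_le_one _)

theorem summable_norm_coeff_mul_pow {z : K} (hz : ‖z‖ < 1) (f : PowerSeries ℤ_[p]) :
    Summable fun n => ‖padicIntInclusion K (PowerSeries.coeff n f) * z ^ n‖ :=
  Summable.of_nonneg_of_le (fun _ => norm_nonneg _) (norm_coeff_mul_pow_le z f)
    (summable_geometric_of_lt_one (norm_nonneg _) hz)

/-- Evaluation of power series over `ℤ_p` at a point of the open unit disc. -/
noncomputable def powerSeriesEval [CompleteSpace K] (z : K) (hz : ‖z‖ < 1) :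
    PowerSeries ℤ_[p] →+* K where
  toFun := powerSeriesValue z
  map_one' := by
    rw [powerSeriesValue, tsum_eq_single 0]
    · simp
    · intro n hn
      simp [PowerSeries.coeff_one, hn]
  map_zero' := by simp [powerSeriesValue]
  map_add' f g := by
    have hs := fun f : PowerSeries ℤ_[p] => (summable_norm_coeff_mul_pow hz f).of_norm
    rw [powerSeriesValue, powerSeriesValue, powerSeriesValue, ← (hs f).tsum_add (hs g)]
    simp [add_mul]
  map_mul' f g := by
    rw [powerSeriesValue, powerSeriesValue, powerSeriesValue,
      tsum_mul_tsum_eq_tsum_sum_antidiagonal_of_summable_norm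
        (summable_norm_coeff_mul_pow hz f) (summable_norm_coeff_mul_pow hz g)]
    refine tsum_congr fun n => ?_
    rw [PowerSeries.coeff_mul, map_sum, Finset.sum_mul]
    refine Finset.sum_congr rfl fun kl hkl => ?_
    rw [← Finset.HasAntidiagonal.mem_antidiagonal.mp hkl, map_mul, pow_add]
    ring

/-- The norm of the value of a non-zero power series near the boundary of the unit disc. -/
theorem exists_norm_powerSeriesValue_eq {f : PowerSeries ℤ_[p]} (hf : f ≠ 0) :
    ∃ μ l : ℕ, (PowerSeries.constantCoeff f = 0 → 1 ≤ l) ∧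
      ∀ (K : Type) [NormedField K] [NormedAlgebra ℚ_[p] K] [IsUltrametricDist K]
        [CompleteSpace K] (z : K), ‖z‖ < 1 → (p : ℝ)⁻¹ < ‖z‖ ^ l →
        ‖powerSeriesValue z f‖ = ((p : ℝ)⁻¹) ^ μ * ‖z‖ ^ l := by
  classical
  have hp1 : (1 : ℝ) < p := mod_cast (Fact.out : p.Prime).one_lt
  have hp0 : (0 : ℝ) < (p : ℝ)⁻¹ := by positivity
  have hnorm : ∀ x : ℤ_[p], x ≠ 0 → ‖x‖ = ((p : ℝ)⁻¹) ^ x.valuation := fun x hx => by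
    rw [PadicInt.norm_eq_zpow_neg_valuation hx, _root_.zpow_neg, zpow_natCast, inv_pow]
  -- `μ` is the least valuation of a coefficient and `l` the first index attaining it, as in
  -- Weierstrass preparation.
  have hex : ∃ μ n, PowerSeries.coeff n f ≠ 0 ∧ (PowerSeries.coeff n f).valuation = μ := by
    obtain ⟨n, hn⟩ := (PowerSeries.exists_coeff_ne_zero_iff_ne_zero).mpr hf
    exact ⟨_, n, hn, rfl⟩
  have hex2 := Nat.find_spec hex
  have hmin : ∀ n, PowerSeries.coeff n f ≠ 0 →
      Nat.find hex ≤ (PowerSeries.coeff n f).valuation := fun n hn =>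
    Nat.find_min' hex ⟨n, hn, rfl⟩
  generalize Nat.find hex = μ at hex2 hmin
  obtain ⟨hl0, hlμ⟩ := Nat.find_spec hex2
  have hlmin : ∀ n, n < Nat.find hex2 → PowerSeries.coeff n f ≠ 0 →
      μ + 1 ≤ (PowerSeries.coeff n f).valuation := fun n hn h0 =>
    lt_of_le_of_ne (hmin n h0) fun h => Nat.find_min hex2 hn ⟨h0, h.symm⟩
  generalize Nat.find hex2 = l at hl0 hlμ hlmin
  refine ⟨μ, l, fun hc => ?_, ?_⟩
  · rw [Nat.one_le_iff_ne_zero]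
    rintro rfl
    exact hl0 (by rw [PowerSeries.coeff_zero_eq_constantCoeff_apply, hc])
  · intro K _ _ _ _ z hz hzl
    have hinv1 : (p : ℝ)⁻¹ < 1 := inv_lt_one_of_one_lt₀ hp1
    have hpos : 0 < ‖z‖ ^ l := hp0.trans hzl
    have hsum := (summable_norm_coeff_mul_pow hz f).of_norm
    have hμ : 0 < ((p : ℝ)⁻¹) ^ μ := pow_pos hp0 μ
    set a : ℕ → K := fun n => padicIntInclusion K (PowerSeries.coeff n f) * z ^ n with ha
    have hal : ‖a l‖ = ((p : ℝ)⁻¹) ^ μ * ‖z‖ ^ l := by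
      rw [ha, norm_mul, norm_padicIntInclusion, norm_pow, hnorm _ hl0, hlμ]
    -- Terms before `l` gain a factor `p` in the coefficient, terms after `l` a factor `z`. As `1/p
    -- < ‖z‖ ^ l`, term `l` strictly dominates both.
    set C : ℝ := max (((p : ℝ)⁻¹) ^ (μ + 1)) (((p : ℝ)⁻¹) ^ μ * ‖z‖ ^ (l + 1)) with hC
    have hC0 : 0 ≤ C := le_max_of_le_left (by positivity)
    have hClt : C < ((p : ℝ)⁻¹) ^ μ * ‖z‖ ^ l := by
      refine max_lt ?_ ?_
      · rw [pow_succ]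
        exact mul_lt_mul_of_pos_left hzl hμ
      · refine mul_lt_mul_of_pos_left ?_ hμ
        rw [pow_succ]
        exact mul_lt_of_lt_one_right hpos hz
    have hrest : ‖∑' n, if n = l then 0 else a n‖ ≤ C := by
      refine IsUltrametricDist.norm_tsum_le_of_forall_le fun n => ?_
      split_ifs with hn
      · simpa using hC0
      · by_cases h0 : PowerSeries.coeff n f = 0
        · simp only [ha, h0, map_zero, zero_mul, norm_zero]
          exact hC0
        · rw [ha, norm_mul, norm_padicIntInclusion, norm_pow, hnorm _ h0]
          rcases lt_or_gt_of_ne hn with hlt | hgt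
          · refine le_max_of_le_left ?_
            refine (mul_le_of_le_one_right (by positivity)
              (pow_le_one₀ (norm_nonneg _) hz.le)).trans ?_
            exact pow_le_pow_of_le_one hp0.le hinv1.le (hlmin n hlt h0)
          · refine le_max_of_le_right ?_
            exact mul_le_mul (pow_le_pow_of_le_one hp0.le hinv1.le (hmin n h0))
              (pow_le_pow_of_le_one (norm_nonneg _) hz.le hgt) (by positivity) hμ.le
    have hlt := hrest.trans_lt (hClt.trans_eq hal.symm)
    rw [powerSeriesValue, hsum.tsum_eq_add_tsum_ite l,
      IsUltrametricDist.norm_add_eq_max_of_norm_ne_norm hlt.ne', max_eq_left hlt.le, hal]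

/-- The additive character of `ℤ_p` with value `z` at `1`. -/
noncomputable def padicChar (z : K) (x : ℤ_[p]) : K :=
  powerSeriesValue (z - 1) (PowerSeries.binomialSeries ℤ_[p] x)

/-- Pulled back to `ℤ_p`, `χ` is locally constant, hence continuous, so its Mahler expansion is the
binomial series of `(1 + T)^x` at `T = χ 1 - 1`. -/
theorem padicChar_eq [IsUltrametricDist K] [CompleteSpace K] {n : ℕ}
    (χ : AddChar (ZMod (p ^ n)) K) (hχ : ‖χ 1 - 1‖ < 1) (x : ℤ_[p]) :
    padicChar (χ 1) x = χ (PadicInt.toZModPow n x) := by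
  let _ : Algebra ℤ_[p] K := (padicIntInclusion K).toAlgebra
  have hsmul : ∀ (a : ℤ_[p]) (b : K), a • b = padicIntInclusion K a * b := fun a b => rfl
  have : IsBoundedSMul ℤ_[p] K := IsBoundedSMul.of_norm_smul_le fun a b => by
    rw [hsmul, norm_mul, norm_padicIntInclusion]
  let κ : AddChar ℤ_[p] K := χ.compAddMonoidHom
    (PadicInt.toZModPow n : ℤ_[p] →+* ZMod (p ^ n)).toAddMonoidHom
  have hκ : Continuous κ := by
    have hloc : IsLocallyConstant κ := by
      rw [IsLocallyConstant.iff_exists_open]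
      intro a
      refine ⟨Metric.ball a ((p : ℝ) ^ (-(n : ℤ) + 1)), Metric.isOpen_ball,
        Metric.mem_ball_self (by have := (Fact.out : p.Prime).pos; positivity), fun b hb => ?_⟩
      rw [Metric.mem_ball, dist_eq_norm, ← PadicInt.norm_le_pow_iff_norm_lt_pow_add_one,
        PadicInt.norm_le_pow_iff_mem_span_pow, ← PadicInt.ker_toZModPow, RingHom.mem_ker,
        map_sub, sub_eq_zero] at hb
      exact congrArg χ hb
    exact hloc.continuous
  have hr : Filter.Tendsto ((χ 1 - 1) ^ ·) Filter.atTop (nhds 0) :=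
    tendsto_pow_atTop_nhds_zero_of_norm_lt_one hχ
  have h1 := PadicInt.eq_addChar_of_value_at_one hr hκ (by
    change χ (PadicInt.toZModPow n 1) = _
    rw [map_one]; ring)
  have h2 : κ x = ∑' k, mahler k x • (χ 1 - 1) ^ k := by
    rw [h1, PadicInt.coe_addChar_of_value_at_one, PadicInt.mahlerSeries_apply hr]
  change _ = κ x
  rw [h2, padicChar, powerSeriesValue]
  refine tsum_congr fun k => ?_
  rw [hsmul, PowerSeries.binomialSeries_coeff, mahler_apply, smul_eq_mul, mul_one]

end PadicEval

/-! ### Absolute values of `ζ - 1` for `p`-power roots of unity. -/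

section RootsOfUnity

theorem norm_natCast_prime (p : ℕ) [Fact p.Prime] (K : Type*) [NormedField K]
    [NormedAlgebra ℚ_[p] K] : ‖(p : K)‖ = (p : ℝ)⁻¹ := by
  rw [← map_natCast (algebraMap ℚ_[p] K), norm_algebraMap', Padic.norm_p]

variable {p : ℕ} [Fact p.Prime] {K : Type*} [NormedField K] [NormedAlgebra ℚ_[p] K]

theorem norm_eq_one_of_pow_eq_one_of_ne_zero {z : K} {m : ℕ} (hm : m ≠ 0) (h : z ^ m = 1) : ‖z‖ = 1 := by
  rw [← pow_eq_one_iff_of_nonneg (norm_nonneg _) hm, ← norm_pow, h, norm_one]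

theorem norm_pow_sub_one_le [IsUltrametricDist K] {z : K} (h : ‖z‖ = 1) (a : ℕ) :
    ‖z ^ a - 1‖ ≤ ‖z - 1‖ := by
  rw [← geom_sum_mul, norm_mul]
  refine mul_le_of_le_one_left (norm_nonneg _) ?_
  refine IsUltrametricDist.norm_sum_le_of_forall_le_of_nonneg zero_le_one fun i _ => ?_
  rw [norm_pow, h, one_pow]

/-- The cyclotomic polynomial of order `p ^ (n + 1)` takes the value `p` at `1`. -/
theorem prod_norm_primitiveRoots_sub_one {z : K} {n : ℕ} (hz : IsPrimitiveRoot z (p ^ (n + 1))) :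
    ∏ w ∈ primitiveRoots (p ^ (n + 1)) K, ‖w - 1‖ = (p : ℝ)⁻¹ := by
  have h := Polynomial.cyclotomic_eq_prod_X_sub_primitiveRoots hz
  have h1 := congrArg (Polynomial.eval 1) h
  rw [Polynomial.eval_one_cyclotomic_prime_pow, Polynomial.eval_prod] at h1
  rw [← norm_natCast_prime p K, h1, norm_prod]
  refine Finset.prod_congr rfl fun w _ => ?_
  simp [norm_sub_rev]

/-- Primitive roots are powers of one another, so all the factors `‖w - 1‖` of the preceding product
are equal. -/
theorem norm_sub_one_pow_totient [IsUltrametricDist K] {z : K} {n : ℕ}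
    (hz : IsPrimitiveRoot z (p ^ (n + 1))) :
    ‖z - 1‖ ^ (p ^ (n + 1)).totient = (p : ℝ)⁻¹ := by
  have hpn : p ^ (n + 1) ≠ 0 := pow_ne_zero _ (Fact.out : p.Prime).ne_zero
  have hle : ∀ {z w : K}, IsPrimitiveRoot z (p ^ (n + 1)) → IsPrimitiveRoot w (p ^ (n + 1)) →
      ‖w - 1‖ ≤ ‖z - 1‖ := by
    intro z w hz hw
    have : NeZero (p ^ (n + 1)) := ⟨hpn⟩
    obtain ⟨i, -, rfl⟩ := hz.eq_pow_of_pow_eq_one hw.pow_eq_one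
    exact norm_pow_sub_one_le (norm_eq_one_of_pow_eq_one_of_ne_zero hpn hz.pow_eq_one) i
  rw [← prod_norm_primitiveRoots_sub_one (p := p) (n := n) hz, ← hz.card_primitiveRoots, ← Finset.prod_const]
  refine Finset.prod_congr rfl fun w hw => ?_
  have hw := (mem_primitiveRoots (Nat.pos_of_ne_zero hpn)).mp hw
  exact le_antisymm (hle hw hz) (hle hz hw)

theorem norm_sub_one_lt_one [IsUltrametricDist K] {z : K} {n : ℕ} (hz : z ^ p ^ n = 1) :
    ‖z - 1‖ < 1 := by
  induction n with
  | zero =>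
    rw [pow_zero, pow_one] at hz
    simp [hz]
  | succ n ih =>
    by_cases h : z ^ p ^ n = 1
    · exact ih h
    · have hprim : IsPrimitiveRoot z (p ^ (n + 1)) :=
        IsPrimitiveRoot.iff_orderOf.mpr (orderOf_eq_prime_pow h hz)
      have := norm_sub_one_pow_totient (p := p) hprim
      by_contra! hge
      have h1 : (1 : ℝ) ≤ (p : ℝ)⁻¹ := this ▸ one_le_pow₀ hge
      exact absurd h1 (not_le.mpr (inv_lt_one_of_one_lt₀
        (mod_cast (Fact.out : p.Prime).one_lt)))

/-- This supplies the dominance condition of `exists_norm_powerSeriesValue_eq`; it holds because `l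
≤ n < p ^ n ≤ φ(p ^ (n + 1))`. -/
theorem inv_lt_norm_sub_one_pow [IsUltrametricDist K] {z : K} {n l : ℕ}
    (hz : IsPrimitiveRoot z (p ^ (n + 1))) (hl : l ≤ n) : (p : ℝ)⁻¹ < ‖z - 1‖ ^ l := by
  have hp := (Fact.out : p.Prime)
  have h := norm_sub_one_pow_totient (p := p) hz
  have hp0 : (0 : ℝ) < (p : ℝ)⁻¹ := inv_pos.mpr (mod_cast hp.pos)
  have hlt := norm_sub_one_lt_one (p := p) hz.pow_eq_one
  have htot : l < (p ^ (n + 1)).totient := by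
    rw [Nat.totient_prime_pow_succ hp]
    calc l ≤ n := hl
      _ < p ^ n := Nat.lt_pow_self hp.one_lt
      _ ≤ p ^ n * (p - 1) := Nat.le_mul_of_pos_right _ (by have := hp.two_le; omega)
  have hpos : 0 < ‖z - 1‖ := by
    refine lt_of_le_of_ne (norm_nonneg _) fun h0 => ?_
    rw [← h0, zero_pow (by omega)] at h
    exact hp0.ne h
  rw [← h]
  exact pow_lt_pow_right_of_lt_one₀ hpos hlt htot

end RootsOfUnity

theorem Polynomial.nthRootsFinset_prime_pow_succ (p : ℕ) [Fact p.Prime] (K : Type*) [Field K]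
    [DecidableEq K] (n : ℕ) :
    (nthRootsFinset (p ^ (n + 1)) (1 : K)).erase 1 =
      (nthRootsFinset (p ^ n) (1 : K)).erase 1 ∪ primitiveRoots (p ^ (n + 1)) K := by
  have hpos : ∀ m, 0 < p ^ m := fun m => pow_pos (Fact.out : p.Prime).pos m
  have hone : 1 < p ^ (n + 1) := Nat.one_lt_pow (by omega) (Fact.out : p.Prime).one_lt
  ext z
  simp only [Finset.mem_erase, Finset.mem_union, mem_nthRootsFinset (hpos _),
    mem_primitiveRoots (hpos _)]
  constructor
  · rintro ⟨h1, hz⟩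
    by_cases h : z ^ p ^ n = 1
    · exact Or.inl ⟨h1, h⟩
    · exact Or.inr (IsPrimitiveRoot.iff_orderOf.mpr (orderOf_eq_prime_pow h hz))
  · rintro (⟨h1, hz⟩ | hz)
    · exact ⟨h1, by rw [pow_succ, pow_mul, hz, one_pow]⟩
    · exact ⟨hz.ne_one hone, hz.pow_eq_one⟩

theorem Polynomial.disjoint_nthRootsFinset_primitiveRoots (p : ℕ) [Fact p.Prime] (K : Type*)
    [Field K] [DecidableEq K] (n : ℕ) :
    Disjoint ((nthRootsFinset (p ^ n) (1 : K)).erase 1) (primitiveRoots (p ^ (n + 1)) K) := by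
  have hpos : ∀ m, 0 < p ^ m := fun m => pow_pos (Fact.out : p.Prime).pos m
  rw [Finset.disjoint_left]
  intro z hz hz'
  rw [Finset.mem_erase, mem_nthRootsFinset (hpos _)] at hz
  rw [mem_primitiveRoots (hpos _)] at hz'
  exact hz'.pow_ne_one_of_pos_of_lt (hpos n).ne'
    (Nat.pow_lt_pow_right (Fact.out : p.Prime).one_lt n.lt_succ_self) hz.2

/-! ### The tower: finite layers and the interpolating power series. -/

namespace SerreGraph

/-- Here `k` is the least valuation of a nonzero element of `G`. Subgroups of `ZMod (p ^ n)` are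
ideals, so unit factors do not matter there. -/
theorem exists_map_towerProj_eq {p : ℕ} [Fact p.Prime] {G : AddSubgroup ℤ_[p]} (hG : G ≠ ⊥) :
    ∃ k : ℕ, ∀ n, G.map (towerProj p n) = AddSubgroup.zmultiples ((p ^ k : ℕ) : ZMod (p ^ n)) := by
  classical
  have hex : ∃ k, ∃ g ∈ G, g ≠ 0 ∧ g.valuation = k := by
    obtain ⟨g, hg, hg0⟩ := G.bot_or_exists_ne_zero.resolve_left hG
    exact ⟨_, g, hg, hg0, rfl⟩
  obtain ⟨g, hg, hg0, hgk⟩ := Nat.find_spec hex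
  have hmin : ∀ x ∈ G, x ≠ 0 → Nat.find hex ≤ x.valuation := fun x hx h0 =>
    Nat.find_min' hex ⟨x, hx, h0, rfl⟩
  generalize Nat.find hex = k at hgk hmin
  refine ⟨k, fun n => ?_⟩
  have hNe : NeZero (p ^ n) := ⟨pow_ne_zero _ (Fact.out : p.Prime).ne_zero⟩
  have hsmul : ∀ c d : ZMod (p ^ n), c * d = c.val • d := fun c d => by simp
  apply le_antisymm
  · rintro _ ⟨x, hx, rfl⟩
    by_cases h0 : x = 0
    · rw [h0, map_zero]
      exact zero_mem _
    · obtain ⟨m, hm⟩ := Nat.exists_eq_add_of_le (hmin x hx h0)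
      have h1 : towerProj p n x = PadicInt.toZModPow n
          ((PadicInt.unitCoeff h0 : ℤ_[p]) * (p : ℤ_[p]) ^ m) * ((p ^ k : ℕ) : ZMod (p ^ n)) := by
        change PadicInt.toZModPow n x = _
        conv_lhs => rw [PadicInt.unitCoeff_spec h0, hm]
        simp only [map_mul, map_pow, map_natCast, Nat.cast_pow]
        ring
      rw [h1, hsmul]
      exact nsmul_mem (AddSubgroup.mem_zmultiples _) _
  · rw [AddSubgroup.zmultiples_le]
    have h1 : ((p ^ k : ℕ) : ZMod (p ^ n)) =
        PadicInt.toZModPow n ((PadicInt.unitCoeff hg0)⁻¹ : ℤ_[p]ˣ) * towerProj p n g := by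
      change _ = _ * PadicInt.toZModPow n g
      conv_rhs => enter [2]; rw [PadicInt.unitCoeff_spec hg0, hgk]
      rw [← map_mul, ← mul_assoc, Units.inv_mul, one_mul]
      simp
    rw [h1, hsmul]
    exact nsmul_mem (AddSubgroup.mem_map_of_mem _ hg) _

theorem card_zmultiples_pow {p : ℕ} [Fact p.Prime] {k n : ℕ} (hkn : k ≤ n) :
    Nat.card (AddSubgroup.zmultiples ((p ^ k : ℕ) : ZMod (p ^ n))) = p ^ (n - k) := by
  have hp := (Fact.out : p.Prime)
  rw [Nat.card_zmultiples, ZMod.addOrderOf_coe _ (pow_ne_zero _ hp.ne_zero),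
    Nat.gcd_eq_right (pow_dvd_pow p hkn), Nat.pow_div hkn hp.pos]

theorem card_quotient_zmultiples_pow {p : ℕ} [Fact p.Prime] {k n : ℕ} (hkn : k ≤ n) :
    Nat.card (ZMod (p ^ n) ⧸ AddSubgroup.zmultiples ((p ^ k : ℕ) : ZMod (p ^ n))) = p ^ k := by
  have hp := (Fact.out : p.Prime)
  have h := AddSubgroup.card_eq_card_quotient_mul_card_addSubgroup
    (AddSubgroup.zmultiples ((p ^ k : ℕ) : ZMod (p ^ n)))
  rw [card_zmultiples_pow hkn, Nat.card_zmod] at h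
  refine Nat.eq_of_mul_eq_mul_right (pow_pos hp.pos (n - k)) (h.symm.trans ?_)
  rw [← pow_add, Nat.add_sub_cancel' hkn]

variable {V E : Type*}

section Tower

variable [Fintype V] [DecidableEq V] [Fintype E] (X : SerreGraph V E) {p : ℕ} [Fact p.Prime]
  (𝒢 : V → AddSubgroup ℤ_[p]) (α : X.VoltageAssignment ℤ_[p])

open Classical in
/-- The twisted determinant attached to the character of `ℤ_p` with value `z` at `1`. -/
noncomputable def characterDet (z : ℂ_[p]) : ℂ_[p] :=
  X.twistedDet (fun v => if ∀ x ∈ 𝒢 v, padicChar z x = 1 then 1 else 0)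
    fun e => padicChar z (α.val e)

-- Nontrivial characters are indexed by their value at `1`. The factor of a given root of unity does
-- not depend on the layer, so consecutive layers can be compared.
open Classical in
theorem numSpanningTrees_towerLayer_mul [Nonempty V] (n : ℕ) :
    ((X.towerLayer 𝒢 α n).numSpanningTrees : ℂ_[p]) * (p : ℂ_[p]) ^ n =
      (∏ v, (Nat.card ((𝒢 v).map (towerProj p n)) : ℂ_[p]) ^
        Nat.card (ZMod (p ^ n) ⧸ (𝒢 v).map (towerProj p n))) * X.numSpanningTrees *
      ∏ z ∈ (Polynomial.nthRootsFinset (p ^ n) (1 : ℂ_[p])).erase 1, X.characterDet 𝒢 α z := by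
  have hpn : p ^ n ≠ 0 := pow_ne_zero _ (Fact.out : p.Prime).ne_zero
  have hNe : NeZero (p ^ n) := ⟨hpn⟩
  have : NeZero ((p ^ n : ℕ) : ℂ_[p]) := ⟨Nat.cast_ne_zero.mpr hpn⟩
  obtain ⟨ζ, hζ⟩ := HasEnoughRootsOfUnity.exists_primitiveRoot ℂ_[p] (p ^ n)
  set ψ := AddChar.zmodChar (p ^ n) hζ.pow_eq_one with hψdef
  have hψ : ψ.IsPrimitive := AddChar.zmodChar_primitive_of_primitive_root _ hζ
  have happ : ∀ i : ZMod (p ^ n), ψ i = ζ ^ i.val := fun i => AddChar.zmodChar_apply _ i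
  have hpow : ∀ i : ZMod (p ^ n), ψ i ^ p ^ n = 1 := fun i => by
    rw [happ, ← pow_mul, mul_comm, pow_mul, hζ.pow_eq_one, one_pow]
  have hinj : ∀ i j : ZMod (p ^ n), ψ i = ψ j → i = j := fun i j h => by
    rw [happ, happ] at h
    exact ZMod.val_injective _ (hζ.pow_inj (ZMod.val_lt i) (ZMod.val_lt j) h)
  have hchar : ∀ (i : ZMod (p ^ n)) (x : ℤ_[p]),
      padicChar (ψ i) x = ψ (i * towerProj p n x) := fun i x => by
    have h1 : ψ.mulShift i 1 = ψ i := by rw [AddChar.mulShift_apply, mul_one]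
    have h2 := padicChar_eq (ψ.mulShift i) (by
      rw [h1]; exact norm_sub_one_lt_one (p := p) (hpow i)) x
    rw [h1] at h2
    exact h2
  have h := X.numSpanningTrees_derived_mul ψ hψ (fun v => (𝒢 v).map (towerProj p n))
    (α.map (towerProj p n))
  rw [Nat.cast_pow] at h
  refine h.trans ?_
  congr 1
  refine Finset.prod_nbij (fun i => ψ i) ?_ (fun i _ j _ h => hinj i j h) ?_ ?_
  · intro i hi
    rw [Finset.mem_erase, Polynomial.mem_nthRootsFinset (Nat.pos_of_ne_zero hpn)]
    refine ⟨fun h1 => Finset.ne_of_mem_erase hi (hinj i 0 ?_), hpow i⟩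
    rw [h1, AddChar.map_zero_eq_one]
  · intro z hz
    rw [Finset.mem_coe, Finset.mem_erase,
      Polynomial.mem_nthRootsFinset (Nat.pos_of_ne_zero hpn)] at hz
    obtain ⟨i, hi, rfl⟩ := hζ.eq_pow_of_pow_eq_one hz.2
    have hval : ψ (i : ZMod (p ^ n)) = ζ ^ i := by rw [happ, ZMod.val_natCast_of_lt hi]
    refine ⟨(i : ZMod (p ^ n)), ?_, hval⟩
    rw [Finset.mem_coe, Finset.mem_erase]
    refine ⟨fun h0 => hz.1 ?_, Finset.mem_univ _⟩
    rw [← hval, h0, AddChar.map_zero_eq_one]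
  · intro i _
    rw [characterDet]
    congr 1
    · ext v
      have : (∀ σ ∈ (𝒢 v).map (towerProj p n), ψ (i * σ) = 1) ↔
          ∀ x ∈ 𝒢 v, padicChar (ψ i) x = 1 := by
        simp only [hchar, AddSubgroup.mem_map, forall_exists_index, and_imp,
          forall_apply_eq_imp_iff₂]
      simp only [this]
    · ext e
      rw [hchar]
      rfl

/-- The growth rate of the product of the orders of the groups `Γ_{n,v}`. -/
theorem exists_card_growth : ∃ (s : V → ℕ) (N : ℕ), (∀ v, s v = 0 → 𝒢 v = ⊥) ∧ ∀ n, N ≤ n →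
    (∏ v, (Nat.card ((𝒢 v).map (towerProj p (n + 1))) : ℂ_[p]) ^
        Nat.card (ZMod (p ^ (n + 1)) ⧸ (𝒢 v).map (towerProj p (n + 1)))) =
      (p : ℂ_[p]) ^ (∑ v, s v) * ∏ v, (Nat.card ((𝒢 v).map (towerProj p n)) : ℂ_[p]) ^
        Nat.card (ZMod (p ^ n) ⧸ (𝒢 v).map (towerProj p n)) := by
  classical
  have h : ∀ v, ∃ s N : ℕ, (s = 0 → 𝒢 v = ⊥) ∧ ∀ n, N ≤ n →
      (Nat.card ((𝒢 v).map (towerProj p (n + 1))) : ℂ_[p]) ^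
          Nat.card (ZMod (p ^ (n + 1)) ⧸ (𝒢 v).map (towerProj p (n + 1))) =
        (p : ℂ_[p]) ^ s * (Nat.card ((𝒢 v).map (towerProj p n)) : ℂ_[p]) ^
          Nat.card (ZMod (p ^ n) ⧸ (𝒢 v).map (towerProj p n)) := by
    intro v
    by_cases hv : 𝒢 v = ⊥
    · exact ⟨0, 0, fun _ => hv, fun n _ => by simp [hv, AddSubgroup.map_bot]⟩
    · obtain ⟨k, hk⟩ := exists_map_towerProj_eq hv
      -- For `n ≥ k` the order is `p ^ (n - k)` and the index stays `p ^ k`, so one more layer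
      -- contributes `p ^ (p ^ k)`.
      refine ⟨p ^ k, k, fun h => absurd h (pow_ne_zero _ (Fact.out : p.Prime).ne_zero),
        fun n hn => ?_⟩
      rw [hk, hk, card_zmultiples_pow hn, card_zmultiples_pow (Nat.le_succ_of_le hn),
        card_quotient_zmultiples_pow hn, card_quotient_zmultiples_pow (Nat.le_succ_of_le hn),
        Nat.succ_sub hn]
      push_cast
      rw [pow_succ, mul_pow, mul_comm]
  choose s N hs hN using h
  refine ⟨s, Finset.univ.sup N, hs, fun n hn => ?_⟩
  rw [← Finset.prod_pow_eq_pow_sum, ← Finset.prod_mul_distrib]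
  exact Finset.prod_congr rfl fun v _ =>
    hN v n ((Finset.le_sup (Finset.mem_univ v)).trans hn)

open Classical in
/-- The power series interpolating the twisted determinants at characters of large order. -/
noncomputable def characteristicSeries : PowerSeries ℤ_[p] :=
  X.twistedDet (fun v => if 𝒢 v = ⊥ then 1 else 0)
    fun e => PowerSeries.binomialSeries ℤ_[p] (α.val e)

theorem padicChar_zero (z : ℂ_[p]) : padicChar z (0 : ℤ_[p]) = 1 := by
  rw [padicChar, PowerSeries.binomialSeries_zero, powerSeriesValue, tsum_eq_single 0]
  · simp
  · intro n hn
    simp [PowerSeries.coeff_one, hn]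

/-- If `G_v` has image generated by `p ^ k` and `n ≥ k`, the character takes the value `z ^ (p ^ k)
≠ 1` on `G_v`. Hence the diagonal switches no longer depend on `z`, and evaluation at `z - 1`, a
ring morphism, commutes with the determinant. -/
theorem exists_characterDet_eq : ∃ N : ℕ, ∀ n, N ≤ n → ∀ z : ℂ_[p],
    IsPrimitiveRoot z (p ^ (n + 1)) →
      X.characterDet 𝒢 α z = powerSeriesValue (z - 1) (X.characteristicSeries 𝒢 α) := by
  classical
  have h : ∀ v, ∃ N : ℕ, ∀ n, N ≤ n → ∀ z : ℂ_[p], IsPrimitiveRoot z (p ^ (n + 1)) →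
      ((∀ x ∈ 𝒢 v, padicChar z x = 1) ↔ 𝒢 v = ⊥) := by
    intro v
    by_cases hv : 𝒢 v = ⊥
    · refine ⟨0, fun n _ z _ => iff_of_true (fun x hx => ?_) hv⟩
      rw [hv, AddSubgroup.mem_bot] at hx
      rw [hx, padicChar_zero]
    · obtain ⟨k, hk⟩ := exists_map_towerProj_eq hv
      refine ⟨k, fun n hn z hz => iff_of_false (fun h => ?_) hv⟩
      have hNe : NeZero (p ^ (n + 1)) := ⟨pow_ne_zero _ (Fact.out : p.Prime).ne_zero⟩
      have hmem : ((p ^ k : ℕ) : ZMod (p ^ (n + 1))) ∈ (𝒢 v).map (towerProj p (n + 1)) := by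
        rw [hk]; exact AddSubgroup.mem_zmultiples _
      obtain ⟨x, hx, hxk⟩ := hmem
      have hlt : p ^ k < p ^ (n + 1) :=
        Nat.pow_lt_pow_right (Fact.out : p.Prime).one_lt (Nat.lt_succ_of_le hn)
      have h1 : AddChar.zmodChar (p ^ (n + 1)) hz.pow_eq_one 1 = z := by
        have := AddChar.zmodChar_apply' hz.pow_eq_one 1
        simpa using this
      have h2 := padicChar_eq (AddChar.zmodChar (p ^ (n + 1)) hz.pow_eq_one) (by
        rw [h1]; exact norm_sub_one_lt_one (p := p) hz.pow_eq_one) x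
      rw [h1, h x hx] at h2
      change towerProj p (n + 1) x = _ at hxk
      have h3 : PadicInt.toZModPow (n + 1) x = ((p ^ k : ℕ) : ZMod (p ^ (n + 1))) := hxk
      rw [h3, AddChar.zmodChar_apply'] at h2
      exact hz.pow_ne_one_of_pos_of_lt (pow_ne_zero _ (Fact.out : p.Prime).ne_zero) hlt h2.symm
  choose N hN using h
  refine ⟨Finset.univ.sup N, fun n hn z hz => ?_⟩
  have hlt := norm_sub_one_lt_one (p := p) hz.pow_eq_one
  change _ = powerSeriesEval (z - 1) hlt _
  rw [characteristicSeries, map_twistedDet, characterDet]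
  congr 1
  ext v
  simp only [hN v n ((Finset.le_sup (Finset.mem_univ v)).trans hn) z hz]
  split_ifs <;> simp

/-- At `T = 0` without branching the matrix is the Laplacian of `X`, which kills constants. This is
what keeps the slope nonnegative. -/
theorem constantCoeff_characteristicSeries [Nonempty V] (h : ∀ v, 𝒢 v = ⊥) :
    PowerSeries.constantCoeff (X.characteristicSeries 𝒢 α) = 0 := by
  rw [characteristicSeries, map_twistedDet, twistedDet]
  simp only [h, if_true, map_one, PowerSeries.binomialSeries_constantCoeff, twistedLap_one]
  rw [Matrix.diagonal_one, Matrix.one_mul, add_sub_cancel]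
  refine Matrix.exists_mulVec_eq_zero_iff.mp ⟨fun _ => 1, fun h0 => ?_, ?_⟩
  · exact one_ne_zero (congrFun h0 (Classical.arbitrary V))
  · ext v
    simpa [mulVec, dotProduct] using X.sum_lap_row ℤ_[p] v

end Tower

end SerreGraph

end

/-! ### The growth formula. -/

open SerreGraph in
theorem theorem6p6 {V E : Type*} [Finite V] [Finite E] (p : ℕ) [Fact p.Prime]
    (X : SerreGraph V E) (hX : X.Connected) (α : X.VoltageAssignment ℤ_[p])
    (𝒢 : V → AddSubgroup ℤ_[p]) (h𝒢 : ∀ v, IsClosed (𝒢 v : Set ℤ_[p]))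
    (hconn : ∀ n : ℕ, (X.towerLayer 𝒢 α n).Connected)
    (hchi : ∃ N : ℕ, ∀ n : ℕ, N ≤ n → (X.towerLayer 𝒢 α n).eulerChar < 0) :
    ∃ (μ l : ℕ) (ν : ℤ) (n₀ : ℕ), ∀ n : ℕ, n₀ ≤ n →
      (padicValNat p (X.towerLayer 𝒢 α n).numSpanningTrees : ℤ) =
        (μ : ℤ) * (p : ℤ) ^ n + (l : ℤ) * (n : ℤ) + ν := by
  classical
  have := Fintype.ofFinite V
  have := Fintype.ofFinite E
  have hp := (Fact.out : p.Prime)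
  -- The empty graph has Euler characteristic `0`, which `hchi` excludes.
  rcases isEmpty_or_nonempty V with hV | hV
  · obtain ⟨N, hN⟩ := hchi
    have hE : IsEmpty E := ⟨fun e => hV.elim (X.o e)⟩
    have h := hN N le_rfl
    have : IsEmpty (X.towerLayer 𝒢 α N).UEdge :=
      ⟨fun u => hE.elim ((X.towerLayer 𝒢 α N).rep u).1⟩
    simp [eulerChar] at h
  set κ : ℕ → ℕ := fun n => (X.towerLayer 𝒢 α n).numSpanningTrees with hκ
  have hκ0 : ∀ n, κ n ≠ 0 := fun n => by
    have hNe : NeZero (p ^ n) := ⟨pow_ne_zero _ hp.ne_zero⟩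
    have (v : V) : Fintype (ZMod (p ^ n) ⧸ (𝒢 v).map (towerProj p n)) := Fintype.ofFinite _
    have : Nonempty (Σ v : V, ZMod (p ^ n) ⧸ (𝒢 v).map (towerProj p n)) :=
      ⟨⟨Classical.arbitrary V, 0⟩⟩
    exact numSpanningTrees_ne_zero _ (hconn n)
  have hpC : (p : ℂ_[p]) ≠ 0 := Nat.cast_ne_zero.mpr hp.ne_zero
  obtain ⟨s, N₁, hs, hN₁⟩ := exists_card_growth (p := p) 𝒢
  obtain ⟨N₂, hN₂⟩ := X.exists_characterDet_eq 𝒢 α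
  set F := X.characteristicSeries 𝒢 α with hF
  have hrec : ∀ n, N₁ ≤ n → (κ (n + 1) : ℂ_[p]) * p = (p : ℂ_[p]) ^ (∑ v, s v) * κ n *
      ∏ z ∈ primitiveRoots (p ^ (n + 1)) ℂ_[p], X.characterDet 𝒢 α z := by
    intro n hn
    have h1 := X.numSpanningTrees_towerLayer_mul 𝒢 α n
    have h2 := X.numSpanningTrees_towerLayer_mul 𝒢 α (n + 1)
    rw [hN₁ n hn, Polynomial.nthRootsFinset_prime_pow_succ,
      Finset.prod_union (Polynomial.disjoint_nthRootsFinset_primitiveRoots p ℂ_[p] n)] at h2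
    -- The right side for layer `n` is a factor of that for layer `n + 1`; substituting for it
    -- requires no nonvanishing beyond that of `p ^ n`.
    apply mul_right_cancel₀ (pow_ne_zero n hpC)
    have hpp : (p : ℂ_[p]) ^ (n + 1) = p ^ n * p := pow_succ _ _
    linear_combination h2 - (κ (n + 1) : ℂ_[p]) * hpp - (p : ℂ_[p]) ^ (∑ v, s v) *
      (∏ z ∈ primitiveRoots (p ^ (n + 1)) ℂ_[p], X.characterDet 𝒢 α z) * h1
  have hprim : ∀ n, ∃ z : ℂ_[p], IsPrimitiveRoot z (p ^ n) := fun n => by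
    have hpn : p ^ n ≠ 0 := pow_ne_zero _ hp.ne_zero
    have hNe : NeZero (p ^ n) := ⟨hpn⟩
    have : NeZero ((p ^ n : ℕ) : ℂ_[p]) := ⟨Nat.cast_ne_zero.mpr hpn⟩
    exact HasEnoughRootsOfUnity.exists_primitiveRoot ℂ_[p] (p ^ n)
  -- Were `F = 0`, the recursion would force `κ (n + 1) = 0` for large `n`, against connectedness of
  -- the layers.
  have hF0 : F ≠ 0 := by
    intro h0
    set n := max N₁ N₂
    obtain ⟨z, hz⟩ := hprim (n + 1)
    have h1 := hrec n (le_max_left _ _)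
    rw [Finset.prod_eq_zero ((mem_primitiveRoots (pow_pos hp.pos _)).mpr hz)
      (by rw [hN₂ n (le_max_right _ _) z hz, h0]; simp [powerSeriesValue]), mul_zero] at h1
    exact mul_ne_zero (Nat.cast_ne_zero.mpr (hκ0 (n + 1))) hpC h1
  obtain ⟨μ, l, hl, hval⟩ := exists_norm_powerSeriesValue_eq hF0
  have hpos : 1 ≤ (∑ v, s v) + l := by
    by_contra! hlt
    have hsum : ∑ v, s v = 0 := by omega
    rw [Finset.sum_eq_zero_iff] at hsum
    have := hl (X.constantCoeff_characteristicSeries 𝒢 α fun v => hs v (hsum v (Finset.mem_univ v)))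
    omega
  obtain ⟨n₀, hn₀⟩ : ∃ n₀, N₁ ≤ n₀ ∧ N₂ ≤ n₀ ∧ l ≤ n₀ :=
    ⟨max N₁ (max N₂ l), by simp, by simp, by simp⟩
  have hp0 : (0 : ℝ) < (p : ℝ)⁻¹ := inv_pos.mpr (mod_cast hp.pos)
  have hp1 : (p : ℝ)⁻¹ < 1 := inv_lt_one_of_one_lt₀ (mod_cast hp.one_lt)
  have hnorm : ∀ m : ℕ, m ≠ 0 → ‖(m : ℂ_[p])‖ = ((p : ℝ)⁻¹) ^ padicValNat p m := by
    intro m hm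
    rw [← map_natCast (algebraMap ℚ_[p] ℂ_[p]), norm_algebraMap',
      Padic.norm_eq_zpow_neg_valuation (Nat.cast_ne_zero.mpr hm), Padic.valuation_natCast,
      _root_.zpow_neg, zpow_natCast, inv_pow]
  have hstep : ∀ n, n₀ ≤ n → padicValNat p (κ (n + 1)) + 1 =
      (∑ v, s v) + padicValNat p (κ n) + (μ * (p ^ (n + 1)).totient + l) := by
    intro n hn
    obtain ⟨z₀, hz₀⟩ := hprim (n + 1)
    have hprod : ∏ z ∈ primitiveRoots (p ^ (n + 1)) ℂ_[p], ‖X.characterDet 𝒢 α z‖ =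
        ((p : ℝ)⁻¹) ^ (μ * (p ^ (n + 1)).totient + l) := by
      have h1 : ∀ z ∈ primitiveRoots (p ^ (n + 1)) ℂ_[p], ‖X.characterDet 𝒢 α z‖ =
          ((p : ℝ)⁻¹) ^ μ * ‖z - 1‖ ^ l := by
        intro z hz
        rw [mem_primitiveRoots (pow_pos hp.pos _)] at hz
        rw [hN₂ n (hn₀.2.1.trans hn) z hz]
        exact hval ℂ_[p] (z - 1) (norm_sub_one_lt_one (p := p) hz.pow_eq_one)
          (inv_lt_norm_sub_one_pow hz (hn₀.2.2.trans hn))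
      rw [Finset.prod_congr rfl h1, Finset.prod_mul_distrib, Finset.prod_const,
        hz₀.card_primitiveRoots, Finset.prod_pow, prod_norm_primitiveRoots_sub_one hz₀,
        ← pow_mul, ← pow_add]
    have h2 := congrArg norm (hrec n (hn₀.1.trans hn))
    rw [norm_mul, norm_mul, norm_mul, norm_prod, hprod, norm_pow, hnorm _ (hκ0 _),
      hnorm _ (hκ0 _), norm_natCast_prime p ℂ_[p], ← pow_succ, ← pow_add, ← pow_add] at h2
    exact pow_right_injective₀ hp0 hp1.ne h2
  -- The `- 1` comes from the factor `p` on the left of `hrec`; the natural subtraction is exact by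
  -- `hpos`. Since `φ(p ^ (n + 1)) = p ^ (n + 1) - p ^ n`, the `μ` part telescopes, and `ν` is fixed
  -- by the value at `n₀`.
  refine ⟨μ, (∑ v, s v) + l - 1, (padicValNat p (κ n₀) : ℤ) - μ * (p : ℤ) ^ n₀ -
    (((∑ v, s v) + l - 1 : ℕ) : ℤ) * n₀, n₀, fun n hn => ?_⟩
  change (padicValNat p (κ n) : ℤ) = _
  induction n, hn using Nat.le_induction with
  | base => ring
  | succ n hn ih =>
    have h := hstep n hn
    rw [Nat.totient_prime_pow_succ hp] at h
    have h' : (padicValNat p (κ (n + 1)) : ℤ) + 1 = (∑ v, s v : ℕ) + padicValNat p (κ n) +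
        (μ * (p ^ n * ((p : ℤ) - 1)) + l) := by
      have := congrArg (Nat.cast : ℕ → ℤ) h
      push_cast [Nat.cast_sub hp.one_le] at this ⊢
      exact this
    rw [Nat.cast_sub hpos] at ih ⊢
    push_cast at ih h' ⊢
    rw [pow_succ]
    linear_combination h' + ih
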